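/- Let $\mathcal S(\mathbb Z)$ be the space of rapidly decreasing sequences $\mathbb Z\to\mathbb C$, and let $(\mathcal A,W)$ be either $(\mathcal S(\mathbb Z),\mathcal S(\mathbb Z))$ or $(\ell^1(\mathbb Z),\ell^2(\mathbb Z))$. Let $\mathcal E$ be the shift, $(\mathcal Ef)(n)=f(n+1)$, $\mathcal E^j a=(\mathcal E^j a)\mathcal E^j$, and let $\mathcal G$ be the Lie algebra spanned by the formal operators $\mathcal E^m+\sum_{j<m}a_j\mathcal E^j$, $m\ge 1$, $a_j\in\mathcal A$. For $A=\sum_j a_j\mathcal E^j$ put $\mathrm{Tr}\,A=\sum_n a_0(n)$, $A_+=\sum_{j\ge0}a_j\mathcal E^j$, $A_{>0}=\sum_{j>0}a_j\mathcal E^j$, $A^*=\sum_j\mathcal E^{-j}a_j$. Identify $\mathcal G^*$ with $\mathcal G$ through $(A,B)=\mathrm{Tr}(AB)$ and $W^*$ with $W$ through $\langle f,g\rangle=\sum_n f(n)g(n)$, and write $\mathcal E(\mathcal E-1)^{-1}=\sum_{k\ge0}\mathcal E^{-k}$. Let $N\in\mathbb N$. On the phase space $\mathcal G^*\oplus W^{2N}$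 of triples $(l,\mathbf f,\mathbf f^*)$, $\mathbf f=(f_i)_{i=1}^N$, $\mathbf f^*=(f_i^*)_{i=1}^N$, consider the map $$B(\tilde l,\mathbf f,\mathbf f^*)=\Big(\tilde l+\sum_{i=1}^N f_i\,\mathcal E(\mathcal E-1)^{-1}f_i^*,\ \mathbf f,\ \mathbf f^*\Big),$$ and, for covectors $(r,\chi,\rho)\in\mathcal G\oplus W^{2N}$, the operators $$\tilde\Theta_{(l,\mathbf f,\mathbf f^*)}(r,\chi,\rho)=\big([l,r_+]-[l,r]_{>0},\,-\rho,\,\chi\big),$$ $$\Theta_{(l,\mathbf f,\mathbf f^*)}(r,\chi,\rho)=\begin{pmatrix}[l,r_+]-[l,r]_{>0}+\sum_{i=1}^N\big(f_i\,\mathcal E(\mathcal E-1)^{-1}\chi_i-\rho_i\,\mathcal E(\mathcal E-1)^{-1}f_i^*\big)\\ -\rho-r_+\mathbf f\\ \chi+r_+^*\mathbf f^*\end{pmatrix}.$$ Then: 1. $B$ is a bijection of the phase space onto itself; it maps the points with $l$ of the form $\mathcal E^m+\sum_{j<m}a_j\mathcal E^j$ onto themselves for each $m\ge1$. Its derivative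 at $(l,\mathbf f,\mathbf f^*)$ is $B'(h,\alpha,\beta)=\big(h+\sum_i(\alpha_i\mathcal E(\mathcal E-1)^{-1}f_i^*+f_i\mathcal E(\mathcal E-1)^{-1}\beta_i),\alpha,\beta\big)$, with conjugate operator $B'^*(r,\chi,\rho)=(r,\chi+r_+^*\mathbf f^*,\rho+r_+\mathbf f)$, and $\Theta=B'\tilde\Theta B'^*$, where the left side is taken at $B(z)$ and the right side at $z$. 2. $\tilde\Theta$ and $\Theta$ are Poisson structures (implectic operators): linear, skew-symmetric, and satisfying the Jacobi identity, i.e. $(\beta,\Theta'[\Theta\alpha]\gamma)+\text{cyclic}=0$. If $l=\mathcal E^m+\sum_{j<m}a_j\mathcal E^j$ with $m\ge1$, $a_j\in\mathcal A$, then the first component of $\Theta(r,\chi,\rho)$ has the form $\sum_{j<m}h_j\mathcal E^j$ with $h_j\in\mathcal A$. 3. For every $n\ge1$ the functional $\gamma_n(l)=\frac1{n+1}(l,l^n)$ is a well-defined smooth functional with the unique gradient $\nabla\gamma_n(l)=l^n$, so that its gradient on the phase space is $(l^n,0,0)$; it is a Casimir functional, $[l,\nabla\gamma_n(l)]=0$;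 and the coupled system $$\frac{dl}{dt_n}=[\mathcal R\nabla\gamma_n(l),l]=[(\nabla\gamma_n(l))_+,l],\quad \frac{df_i}{dt_n}=(\nabla\gamma_n(l))_+f_i,\quad \frac{df_i^*}{dt_n}=-(\nabla\gamma_n(l))_+^*f_i^*,\quad i=1,\dots,N,$$ where $\mathcal R A=A_+-\frac12A$, is the Hamiltonian system $\frac{d}{dt_n}(l,\mathbf f,\mathbf f^*)=-\Theta\,(\nabla\gamma_n(l),0,0)$. The same holds for every functional $\gamma$ of $l$ that has a gradient with $[l,\nabla\gamma(l)]=0$ everywhere. 4. If $l$ has coefficients built from $\mathcal S(\mathbb Z)$ and $f_i,f_i^*\in\ell^2(\mathbb Z)$, then the right-hand sides of the coupled system are again of this kind. -/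

import Mathlib

noncomputable section

namespace ShiftLax

/-! ### Sequence spaces on `ℤ` -/

/-- The Schwartz space `𝒮(ℤ; ℂ)` of rapidly decreasing sequences. -/
def Schwartz : Set (ℤ → ℂ) :=
  {a | ∀ k : ℕ, ∃ C : ℝ, ∀ n : ℤ, |(n : ℝ)| ^ k * ‖a n‖ ≤ C}

/-- Absolutely summable sequences, `ℓ¹(ℤ; ℂ)`. -/
def L1 : Set (ℤ → ℂ) := {a | Summable fun n => ‖a n‖}

/-- Square summable sequences, `ℓ²(ℤ; ℂ) = L₂(ℤ; ℂ)`. -/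
def L2 : Set (ℤ → ℂ) := {a | Summable fun n => ‖a n‖ ^ 2}

/-! ### Formal shift operators -/

/-- A formal expression `A = ∑ j, a_j(n) 𝓔^j`; the value `A j n` is `a_j(n)`. -/
def ShiftOp : Type := ℤ → ℤ → ℂ

instance : AddCommGroup ShiftOp := inferInstanceAs (AddCommGroup (ℤ → ℤ → ℂ))

instance : Module ℂ ShiftOp := inferInstanceAs (Module ℂ (ℤ → ℤ → ℂ))

/-- The product determined by `𝓔^j b = (𝓔^j b) 𝓔^j`, where `(𝓔^j b)(n) = b(n + j)`.  All the sums
over `j` are finite when both orders are bounded above. -/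
instance : Mul ShiftOp := ⟨fun A B k n => ∑ᶠ j : ℤ, A j n * B (k - j) (n + j)⟩

/-- The multiplication operator by a sequence. -/
def mulOp (f : ℤ → ℂ) : ShiftOp := fun j n => if j = 0 then f n else 0

/-- Powers: `l^0 = 1`, `l^(k+1) = l^k l`. -/
def opPow (l : ShiftOp) : ℕ → ShiftOp
  | 0 => mulOp fun _ => 1
  | k + 1 => opPow l k * l

/-- The commutator. -/
def bracket (A B : ShiftOp) : ShiftOp := A * B - B * A

/-- The projection `A_+` onto the part of orders `j ≥ 0`. -/
def pos (A : ShiftOp) : ShiftOp := fun j n => if 0 ≤ j then A j n else 0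

/-- The projection `A_-` onto the part of orders `j < 0`. -/
def neg (A : ShiftOp) : ShiftOp := fun j n => if j < 0 then A j n else 0

/-- `A_{>0} = A_+ - A_0`, the part of orders `j > 0`. -/
def spos (A : ShiftOp) : ShiftOp := fun j n => if 0 < j then A j n else 0

/-- The endomorphism `R = (P_+ - P_-) / 2`. -/
def rMap (A : ShiftOp) : ShiftOp := (1 / 2 : ℂ) • (pos A - neg A)

/-- The action on sequences, `(A f)(n) = ∑ j, a_j(n) f(n + j)` (used for finite sums only). -/
def act (A : ShiftOp) (f : ℤ → ℂ) : ℤ → ℂ := fun n => ∑ᶠ j : ℤ, A j n * f (n + j)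

/-- The adjoint `A^* = ∑ j, 𝓔^{-j} a_j` for the bilinear pairing `⟨f, g⟩ = ∑ n, f(n) g(n)`. -/
def adj (A : ShiftOp) : ShiftOp := fun j n => A (-j) (n + j)

/-- `𝓔 (𝓔 - 1)⁻¹ = ∑ k ≥ 0, 𝓔^{-k}`. -/
def geom : ShiftOp := fun j _ => if j ≤ 0 then 1 else 0

/-- The operator `f 𝓔 (𝓔 - 1)⁻¹ g`. -/
def dyad (f g : ℤ → ℂ) : ShiftOp := mulOp f * geom * mulOp g

/-- `Tr A = ∑ n, a_0(n)`. -/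
def tr (A : ShiftOp) : ℂ := ∑' n : ℤ, A 0 n

/-- The bilinear form `(A, B) = Tr (A B)`. -/
def form (A B : ShiftOp) : ℂ := tr (A * B)

/-- The operators `𝓔^m + ∑_{j < m} a_j 𝓔^j` with all `a_j ∈ 𝒜`. -/
def IsMonic (𝒜 : Set (ℤ → ℂ)) (m : ℕ) (A : ShiftOp) : Prop :=
  (∀ n, A m n = 1) ∧ (∀ j : ℤ, (m : ℤ) < j → ∀ n, A j n = 0) ∧ ∀ j : ℤ, j < m → A j ∈ 𝒜

/-- Tangent vectors to the set of monic operators of order `m`: the operators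
`∑_{j < m} h_j 𝓔^j` with all `h_j ∈ 𝒜`. -/
def IsTangent (𝒜 : Set (ℤ → ℂ)) (m : ℕ) (A : ShiftOp) : Prop :=
  (∀ j : ℤ, (m : ℤ) ≤ j → ∀ n, A j n = 0) ∧ ∀ j : ℤ, A j ∈ 𝒜

/-- The Lie algebra `𝒢` of shift operators with coefficients in `𝒜`, that is, the linear span of
the monic operators `𝓔^m + ∑_{j < m} a_j 𝓔^j`, `m ≥ 1`: the order is bounded above, coefficients
of nonpositive order lie in `𝒜`, those of positive order lie in `ℂ + 𝒜`.  The form `(A, B)`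
identifies `𝒢^*` with `𝒢`. -/
def Alg (𝒜 : Set (ℤ → ℂ)) : Set ShiftOp :=
  {A | (∃ M : ℤ, ∀ j, M < j → ∀ n, A j n = 0) ∧ (∀ j ≤ 0, A j ∈ 𝒜) ∧
    ∀ j > 0, ∃ c : ℂ, (fun n => A j n - c) ∈ 𝒜}

/-! ### The extended phase space -/

/-- Triples `(l, 𝐟, 𝐟^*)`; also used for tangent vectors and, through `pair`, for covectors. -/
abbrev Ext (N : ℕ) : Type := ShiftOp × (Fin N → ℤ → ℂ) × (Fin N → ℤ → ℂ)

/-- The extended phase space `𝒢^* ⊕ W^{2N}`. -/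
def Phase (𝒜 𝒲 : Set (ℤ → ℂ)) (N : ℕ) : Set (Ext N) :=
  {z | z.1 ∈ Alg 𝒜 ∧ (∀ i, z.2.1 i ∈ 𝒲) ∧ ∀ i, z.2.2 i ∈ 𝒲}

/-- The bilinear pairing `⟨f, g⟩ = ∑ n, f(n) g(n)`. -/
def seqPair (f g : ℤ → ℂ) : ℂ := ∑' n : ℤ, f n * g n

/-- The pairing of a covector `ξ = (r, χ, ρ)` with a vector `v = (h, α, β)`. -/
def pair {N : ℕ} (ξ v : Ext N) : ℂ :=
  form ξ.1 v.1 + ∑ i, seqPair (ξ.2.1 i) (v.2.1 i) + ∑ i, seqPair (ξ.2.2 i) (v.2.2 i)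

/-- `ξ = (δF/δl, δF/δ𝐟, δF/δ𝐟^*)` is a gradient of the functional `F` at `z`:
`δF(z)[v] = (ξ, v)` for every variation `v`. -/
def IsGradient (𝒜 𝒲 : Set (ℤ → ℂ)) {N : ℕ} (F : Ext N → ℂ) (z ξ : Ext N) : Prop :=
  ξ ∈ Phase 𝒜 𝒲 N ∧
    ∀ v ∈ Phase 𝒜 𝒲 N, HasDerivAt (fun t : ℂ => F (z + t • v)) (pair ξ v) 0

/-- Smooth functionals on the extended phase space: smooth along all finite families of
directions, with a gradient at every point. -/
def IsSmoothFunctional (𝒜 𝒲 : Set (ℤ → ℂ)) {N : ℕ} (F : Ext N → ℂ) : Prop :=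
  (∀ z ∈ Phase 𝒜 𝒲 N, ∀ (k : ℕ) (v : Fin k → Ext N), (∀ i, v i ∈ Phase 𝒜 𝒲 N) →
    ContDiff ℂ (⊤ : ℕ∞) fun t : Fin k → ℂ => F (z + ∑ i, t i • v i)) ∧
  ∀ z ∈ Phase 𝒜 𝒲 N, ∃ ξ, IsGradient 𝒜 𝒲 F z ξ

/-- `g` is a gradient at `l` of the functional `γ` on `𝒢^*`. -/
def IsOpGradient (𝒜 : Set (ℤ → ℂ)) (γ : ShiftOp → ℂ) (l g : ShiftOp) : Prop :=
  g ∈ Alg 𝒜 ∧ ∀ h ∈ Alg 𝒜, HasDerivAt (fun t : ℂ => γ (l + t • h)) (form g h) 0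

/-- Casimir functionals on `𝒢^*`: `[l, ∇γ(l)] = 0` at every point. -/
def IsCasimir (𝒜 : Set (ℤ → ℂ)) (γ : ShiftOp → ℂ) : Prop :=
  ∀ l ∈ Alg 𝒜, (∃ g, IsOpGradient 𝒜 γ l g) ∧
    ∀ g, IsOpGradient 𝒜 γ l g → bracket l g = 0

/-- Poisson structures on the extended phase space given by implectic operators
`Θ_z : T^* → T`: linear, skew-symmetric, and the bracket
`(α, β, γ) ↦ (β, Θ'[Θ α] γ)` satisfies the Jacobi identity (its cyclic sum vanishes).  The
derivative of `Θ` is taken after pairing with fixed covectors. -/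
structure IsImplectic (𝒜 𝒲 : Set (ℤ → ℂ)) {N : ℕ} (Θ : Ext N → Ext N → Ext N) : Prop where
  mem : ∀ z ∈ Phase 𝒜 𝒲 N, ∀ α ∈ Phase 𝒜 𝒲 N, Θ z α ∈ Phase 𝒜 𝒲 N
  linear : ∀ z ∈ Phase 𝒜 𝒲 N, ∀ α ∈ Phase 𝒜 𝒲 N, ∀ β ∈ Phase 𝒜 𝒲 N, ∀ c : ℂ,
    Θ z (c • α + β) = c • Θ z α + Θ z β
  skew : ∀ z ∈ Phase 𝒜 𝒲 N, ∀ α ∈ Phase 𝒜 𝒲 N, ∀ β ∈ Phase 𝒜 𝒲 N,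
    pair α (Θ z β) = -pair β (Θ z α)
  diff : ∀ z ∈ Phase 𝒜 𝒲 N, ∀ v ∈ Phase 𝒜 𝒲 N, ∀ α ∈ Phase 𝒜 𝒲 N, ∀ β ∈ Phase 𝒜 𝒲 N,
    DifferentiableAt ℂ (fun t : ℂ => pair α (Θ (z + t • v) β)) 0
  jacobi : ∀ z ∈ Phase 𝒜 𝒲 N, ∀ α ∈ Phase 𝒜 𝒲 N, ∀ β ∈ Phase 𝒜 𝒲 N, ∀ γ ∈ Phase 𝒜 𝒲 N,
    deriv (fun t : ℂ => pair β (Θ (z + t • Θ z α) γ)) 0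
      + deriv (fun t : ℂ => pair γ (Θ (z + t • Θ z β) α)) 0
      + deriv (fun t : ℂ => pair α (Θ (z + t • Θ z γ) β)) 0 = 0

/-! ### Poisson structures and the Bäcklund transformation -/

/-- `r ↦ [l, r_+] - [l, r]_{>0}`. -/
def thetaOp (l r : ShiftOp) : ShiftOp := bracket l (pos r) - spos (bracket l r)

/-- The tensor product `Θ̃` of `thetaOp` with the canonical structure
`(χ, ρ) ↦ (-ρ, χ)` on `W^{2N}`. -/
def thetaTilde {N : ℕ} (z ξ : Ext N) : Ext N := (thetaOp z.1 ξ.1, -ξ.2.2, ξ.2.1)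

/-- The Bäcklund transformation
`(l̃, 𝐟, 𝐟^*) ↦ (l̃ + ∑ i, f_i 𝓔 (𝓔 - 1)⁻¹ f_i^*, 𝐟, 𝐟^*)`. -/
def backlund {N : ℕ} (z : Ext N) : Ext N :=
  (z.1 + ∑ i, dyad (z.2.1 i) (z.2.2 i), z.2.1, z.2.2)

/-- The derivative `B'` of the Bäcklund transformation at `z`. -/
def backlundDeriv {N : ℕ} (z v : Ext N) : Ext N :=
  (v.1 + ∑ i, (dyad (v.2.1 i) (z.2.2 i) + dyad (z.2.1 i) (v.2.2 i)), v.2.1, v.2.2)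

/-- The conjugate operator `B'^*` at `z`: `(r, χ, ρ) ↦ (r, χ + r_+^* 𝐟^*, ρ + r_+ 𝐟)`. -/
def backlundAdj {N : ℕ} (z ξ : Ext N) : Ext N :=
  (ξ.1, fun i => ξ.2.1 i + act (adj (pos ξ.1)) (z.2.2 i),
    fun i => ξ.2.2 i + act (pos ξ.1) (z.2.1 i))

/-- The Poisson operator `Θ` at `z = (l, 𝐟, 𝐟^*)`, applied to `ξ = (r, χ, ρ)`. -/
def theta {N : ℕ} (z ξ : Ext N) : Ext N :=
  (bracket z.1 (pos ξ.1) - spos (bracket z.1 ξ.1)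
      + ∑ i, (dyad (z.2.1 i) (ξ.2.1 i) - dyad (ξ.2.2 i) (z.2.2 i)),
    fun i => -ξ.2.2 i - act (pos ξ.1) (z.2.1 i),
    fun i => ξ.2.1 i + act (adj (pos ξ.1)) (z.2.2 i))

/-! ### The hierarchy -/

/-- `γ_n(l) = (l, l^n) / (n + 1)`. -/
def casimir (n : ℕ) (l : ShiftOp) : ℂ := form l (opPow l n) / ((n : ℂ) + 1)

/-- The right-hand side of the coupled system
`dl/dt = [g_+, l]`, `df_i/dt = g_+ f_i`, `df_i^*/dt = -g_+^* f_i^*` with `g = ∇γ(l)`. -/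
def coupledField {N : ℕ} (g : ShiftOp) (z : Ext N) : Ext N :=
  (bracket (pos g) z.1, fun i => act (pos g) (z.2.1 i),
    fun i => -act (adj (pos g)) (z.2.2 i))

end ShiftLax

end

open ShiftLax

noncomputable section

namespace ShiftLax

/-! Poisson structures. The form `(A, B) = Tr (AB)` is symmetric and invariant, and it pairs order
`j` with order `-j`, so the transpose of the projection to positive orders is the projection to
negative orders. Hence `r ↦ [l, r_+] - [l, r]_{>0}` is the Lie–Poisson operator of the bracket `[A,
B]_R = [A_+, B_+] - [A_-, B_-]` (`form_thetaOp`), which is a Lie bracket because the two halves are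
subalgebras. Pairing `Θ_z η` with a covector `ξ` and moving every operator onto the covectors gives
`([ξ, η], z) + ω(ξ, η)`. Here `[ξ, η]` is the bracket of a semidirect product: `r` acts on sequences
through `r_+` and through `-r_+^*`, both representations since `r ↦ r_+` is a homomorphism from the
`R`-bracket to the commutator. The form `ω` is the canonical one on `𝒲^{2N}`, which this action
preserves, so it is a 2-cocycle. An operator affine in `z` with such data satisfies the Jacobi
identity (`isImplectic_of_lieBracket`); `Θ̃` is the case without action. The Jacobi identity for `Θ`
is thus proved directly and not transported along `B`.

Bäcklund transformation. `B` adds a term depending only on `(𝐟, 𝐟^*)`, so it is inverted by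
subtraction; it is quadratic, so its expansion along a line is exact. The relation `Θ = B' Θ̃ B'^*`
reduces to the value of `thetaOp` on a dyadic operator (`thetaOp_dyad`).

Hierarchy. Along a line or a finite family of directions, `Tr (a L^p)` is polynomial, as seen by
peeling off one factor `L` at a time and using cyclicity. This gives smoothness and the gradient
`l^n` of `γ_n` without any topology on operators. Since `[l, l^n] = 0`, the truncated term of `Θ`
vanishes on `(l^n, 0, 0)` and the coupled system remains.

Both choices of `(𝒜, 𝒲)` enter only through closure properties: `𝒜` summable, both spaces stable
under shifts and bounded multipliers, and `𝒲 · 𝒲 ⊆ 𝒜`. -/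

/-- Spaces of bounded sequences that are stable under sums, shifts and products with bounded
sequences and that contain the unit sequences. -/
structure IsSeqSpace (X : Set (ℤ → ℂ)) : Prop where
  add : ∀ f ∈ X, ∀ g ∈ X, f + g ∈ X
  bdd_mul : ∀ b : ℤ → ℂ, (∃ C : ℝ, ∀ n, ‖b n‖ ≤ C) → ∀ f ∈ X, (fun n => b n * f n) ∈ X
  shift : ∀ f ∈ X, ∀ j : ℤ, (fun n => f (n + j)) ∈ X
  single : ∀ m : ℤ, Pi.single m (1 : ℂ) ∈ X
  bdd : ∀ f ∈ X, ∃ C : ℝ, ∀ n, ‖f n‖ ≤ C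

namespace IsSeqSpace

variable {X : Set (ℤ → ℂ)} (hX : IsSeqSpace X)
include hX

theorem smul (c : ℂ) {f : ℤ → ℂ} (hf : f ∈ X) : c • f ∈ X :=
  hX.bdd_mul (fun _ => c) ⟨‖c‖, fun _ => le_rfl⟩ f hf

theorem zero : (0 : ℤ → ℂ) ∈ X := by
  simpa using hX.smul 0 (hX.single 0)

theorem neg {f : ℤ → ℂ} (hf : f ∈ X) : -f ∈ X := by
  simpa using hX.smul (-1) hf

theorem sub {f g : ℤ → ℂ} (hf : f ∈ X) (hg : g ∈ X) : f - g ∈ X := by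
  rw [sub_eq_add_neg]
  exact hX.add _ hf _ (hX.neg hg)

theorem sum {ι : Type*} (s : Finset ι) {f : ι → ℤ → ℂ} (hf : ∀ i ∈ s, f i ∈ X) :
    ∑ i ∈ s, f i ∈ X :=
  Finset.sum_induction f (· ∈ X) (fun a b ha hb => hX.add a ha b hb) hX.zero hf

end IsSeqSpace

/-! ### The spaces `ℓ¹`, `ℓ²` and `𝒮(ℤ)` -/

theorem norm_le_tsum_of_mem_L1 {f : ℤ → ℂ} (hf : f ∈ L1) (n : ℤ) : ‖f n‖ ≤ ∑' m, ‖f m‖ :=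
  hf.le_tsum n fun _ _ => norm_nonneg _

theorem single_norm_summable (m : ℤ) (p : ℕ) (hp : p ≠ 0) :
    Summable fun n => ‖(Pi.single m (1 : ℂ) : ℤ → ℂ) n‖ ^ p := by
  refine summable_of_ne_finset_zero (s := {m}) fun n hn => ?_
  rw [Pi.single_eq_of_ne (by simpa using hn)]
  simp [hp]

theorem isSeqSpace_L1 : IsSeqSpace L1 where
  add f hf g hg := Summable.of_nonneg_of_le (fun _ => norm_nonneg _)
    (fun n => norm_add_le (f n) (g n)) (Summable.add hf hg)
  bdd_mul b hb f hf := by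
    obtain ⟨C, hC⟩ := hb
    refine Summable.of_nonneg_of_le (fun _ => norm_nonneg _) (fun n => ?_) (Summable.mul_left C hf)
    rw [norm_mul]
    exact mul_le_mul_of_nonneg_right (hC n) (norm_nonneg _)
  shift f hf j := (Equiv.addRight j).summable_iff.mpr hf
  single m := by simpa [L1] using single_norm_summable m 1 one_ne_zero
  bdd f hf := ⟨_, norm_le_tsum_of_mem_L1 hf⟩

theorem isSeqSpace_L2 : IsSeqSpace L2 where
  add f hf g hg := by
    refine Summable.of_nonneg_of_le (fun _ => by positivity) (fun n => ?_)
      ((Summable.add hf hg).mul_left 2)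
    have h := norm_add_le (f n) (g n)
    have h0 := norm_nonneg (f n + g n)
    change ‖f n + g n‖ ^ 2 ≤ _
    nlinarith [sq_nonneg (‖f n‖ - ‖g n‖)]
  bdd_mul b hb f hf := by
    obtain ⟨C, hC⟩ := hb
    refine Summable.of_nonneg_of_le (fun _ => by positivity) (fun n => ?_)
      (Summable.mul_left (C ^ 2) hf)
    rw [norm_mul, mul_pow]
    gcongr
    exact hC n
  shift f hf j := (Equiv.addRight j).summable_iff.mpr hf
  single m := single_norm_summable m 2 two_ne_zero
  bdd f hf := by
    -- The summand `1` avoids a square root: `x ≤ 1 + x ^ 2`.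
    refine ⟨1 + ∑' m, ‖f m‖ ^ 2, fun n => ?_⟩
    have h : ‖f n‖ ^ 2 ≤ ∑' m, ‖f m‖ ^ 2 := Summable.le_tsum hf n fun _ _ => by positivity
    nlinarith [sq_nonneg (‖f n‖ - 1)]

theorem isSeqSpace_Schwartz : IsSeqSpace Schwartz where
  add f hf g hg k := by
    obtain ⟨C, hC⟩ := hf k
    obtain ⟨D, hD⟩ := hg k
    refine ⟨C + D, fun n => ?_⟩
    calc |(n : ℝ)| ^ k * ‖(f + g) n‖ ≤ |(n : ℝ)| ^ k * (‖f n‖ + ‖g n‖) := by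
          gcongr
          exact norm_add_le _ _
      _ ≤ C + D := by rw [mul_add]; exact add_le_add (hC n) (hD n)
  bdd_mul b hb f hf k := by
    obtain ⟨B, hB⟩ := hb
    obtain ⟨C, hC⟩ := hf k
    refine ⟨B * C, fun n => ?_⟩
    have hB0 : 0 ≤ B := (norm_nonneg _).trans (hB n)
    calc |(n : ℝ)| ^ k * ‖b n * f n‖ = ‖b n‖ * (|(n : ℝ)| ^ k * ‖f n‖) := by rw [norm_mul]; ring
      _ ≤ B * C := mul_le_mul (hB n) (hC n) (by positivity) hB0
  shift f hf j k := by
    obtain ⟨C, hC⟩ := hf k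
    obtain ⟨D, hD⟩ := hf 0
    -- From `|n| ≤ |n + j| + |j|` and convexity of the power: `C` bounds the part with `|n + j| ^
    -- k`, and the sup bound `D` the part with `|j| ^ k`.
    refine ⟨2 ^ k * (C + |(j : ℝ)| ^ k * D), fun n => ?_⟩
    have h1 : |(n : ℝ)| ^ k ≤ 2 ^ k * (|((n + j : ℤ) : ℝ)| ^ k + |(j : ℝ)| ^ k) := by
      have h2 : |(n : ℝ)| ≤ |((n + j : ℤ) : ℝ)| + |(j : ℝ)| := by
        push_cast
        simpa using abs_sub ((n : ℝ) + j) j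
      calc |(n : ℝ)| ^ k ≤ (|((n + j : ℤ) : ℝ)| + |(j : ℝ)|) ^ k := by gcongr
        _ ≤ 2 ^ (k - 1) * (|((n + j : ℤ) : ℝ)| ^ k + |(j : ℝ)| ^ k) :=
          add_pow_le (abs_nonneg _) (abs_nonneg _) k
        _ ≤ _ := by
          gcongr
          · norm_num
          · omega
    have h3 := hC (n + j)
    have h4 := hD (n + j)
    simp only [pow_zero, one_mul] at h4
    calc |(n : ℝ)| ^ k * ‖f (n + j)‖
        ≤ 2 ^ k * (|((n + j : ℤ) : ℝ)| ^ k + |(j : ℝ)| ^ k) * ‖f (n + j)‖ := by gcongr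
      _ = 2 ^ k * (|((n + j : ℤ) : ℝ)| ^ k * ‖f (n + j)‖ + |(j : ℝ)| ^ k * ‖f (n + j)‖) := by ring
      _ ≤ _ := by gcongr
  single m k := by
    refine ⟨|(m : ℝ)| ^ k, fun n => ?_⟩
    by_cases h : n = m
    · subst h
      simp
    · rw [Pi.single_eq_of_ne h]
      simp only [norm_zero, mul_zero]
      positivity
  bdd f hf := by simpa using hf 0

theorem Schwartz_subset_L1 : Schwartz ⊆ L1 := by
  intro f hf
  obtain ⟨C, hC⟩ := hf 2
  obtain ⟨D, hD⟩ := hf 0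
  -- The majorant `C / n ^ 2` has value `0` at `n = 0` (division by zero), so the term at `0` is
  -- added separately.
  have hs : Summable fun n : ℤ => C * (1 / |(n : ℝ)| ^ 2) + ‖f n‖ * (if n = 0 then 1 else 0) := by
    refine Summable.add ?_ (summable_of_ne_finset_zero (s := {0}) fun n hn => ?_)
    · refine Summable.mul_left C ?_
      simpa using Real.summable_one_div_int_pow.mpr one_lt_two
    · simp [show n ≠ 0 by simpa using hn]
  refine Summable.of_nonneg_of_le (fun _ => norm_nonneg _) (fun n => ?_) hs
  by_cases h : n = 0
  · simp [h]
  · have hn : 0 < |(n : ℝ)| ^ 2 := by positivity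
    simp only [h, if_false, mul_zero, add_zero, mul_one_div]
    rw [le_div_iff₀ hn, mul_comm]
    exact hC n

theorem mul_mem_Schwartz {f g : ℤ → ℂ} (hf : f ∈ Schwartz) (hg : g ∈ Schwartz) :
    (fun n => f n * g n) ∈ Schwartz :=
  isSeqSpace_Schwartz.bdd_mul f (isSeqSpace_Schwartz.bdd f hf) g hg

theorem mul_mem_L1 {f g : ℤ → ℂ} (hf : f ∈ L2) (hg : g ∈ L2) : (fun n => f n * g n) ∈ L1 := by
  refine Summable.of_nonneg_of_le (fun _ => norm_nonneg _) (fun n => ?_) (Summable.add hf hg)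
  rw [norm_mul]
  nlinarith [sq_nonneg (‖f n‖ - ‖g n‖), sq_nonneg (‖f n‖), sq_nonneg (‖g n‖)]

/-! ### The ring of shift operators of bounded order -/

@[ext] theorem ShiftOp.ext {A B : ShiftOp} (h : ∀ j n, A j n = B j n) : A = B :=
  funext fun j => funext fun n => h j n

@[simp] theorem ShiftOp.add_apply (A B : ShiftOp) (j n : ℤ) : (A + B) j n = A j n + B j n := rfl
@[simp] theorem ShiftOp.sub_apply (A B : ShiftOp) (j n : ℤ) : (A - B) j n = A j n - B j n := rfl
@[simp] theorem ShiftOp.neg_apply (A : ShiftOp) (j n : ℤ) : (-A) j n = -A j n := rfl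
@[simp] theorem ShiftOp.zero_apply (j n : ℤ) : (0 : ShiftOp) j n = 0 := rfl
@[simp] theorem ShiftOp.smul_apply (c : ℂ) (A : ShiftOp) (j n : ℤ) : (c • A) j n = c * A j n := rfl

theorem ShiftOp.mul_apply (A B : ShiftOp) (k n : ℤ) :
    (A * B) k n = ∑ᶠ j : ℤ, A j n * B (k - j) (n + j) := rfl

/-- The order of `A` is at most `a`. -/
def OrdLE (a : ℤ) (A : ShiftOp) : Prop := ∀ j, a < j → ∀ n, A j n = 0

namespace OrdLE

variable {a b : ℤ} {A B : ShiftOp}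

theorem mono (hA : OrdLE a A) (h : a ≤ b) : OrdLE b A := fun j hj n => hA j (h.trans_lt hj) n

theorem add (hA : OrdLE a A) (hB : OrdLE a B) : OrdLE a (A + B) := fun j hj n => by
  simp [hA j hj, hB j hj]

theorem sub (hA : OrdLE a A) (hB : OrdLE a B) : OrdLE a (A - B) := fun j hj n => by
  simp [hA j hj, hB j hj]

/-- Any larger index set `s` is allowed, so that several products can be summed over one common
range. -/
theorem mul_apply (hA : OrdLE a A) (hB : OrdLE b B) (k n : ℤ) {s : Finset ℤ}
    (hs : Finset.Icc (k - b) a ⊆ s) :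
    (A * B) k n = ∑ j ∈ s, A j n * B (k - j) (n + j) := by
  refine finsum_eq_sum_of_support_subset _ fun j hj => ?_
  refine Finset.mem_coe.mpr (hs ?_)
  rw [Function.mem_support] at hj
  rw [Finset.mem_Icc]
  constructor
  · by_contra h
    exact hj (by rw [hB (k - j) (by omega), mul_zero])
  · by_contra h
    exact hj (by rw [hA j (by omega), zero_mul])

theorem mul (hA : OrdLE a A) (hB : OrdLE b B) : OrdLE (a + b) (A * B) := fun j hj n => by
  rw [hA.mul_apply hB j n subset_rfl, Finset.Icc_eq_empty (by omega), Finset.sum_empty]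

theorem bracket (hA : OrdLE a A) (hB : OrdLE b B) : OrdLE (a + b) (bracket A B) :=
  (hA.mul hB).sub (by rw [add_comm]; exact hB.mul hA)

/-- With `i` in `[k - b - c, a]` and `j` in `[k - c, a + b]`, both sides become one double sum over
a fixed rectangle; in the right-hand product the inner index is shifted by `i`. Bounded order is
essential, since a sum of infinite support has the default value `0`. -/
theorem mul_assoc {c : ℤ} {C : ShiftOp} (hA : OrdLE a A) (hB : OrdLE b B) (hC : OrdLE c C) :
    A * B * C = A * (B * C) := by
  ext k n
  have hj : ∀ j ∈ Finset.Icc (k - c) (a + b), (A * B) j n * C (k - j) (n + j)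
      = ∑ i ∈ Finset.Icc (k - b - c) a, A i n * B (j - i) (n + i) * C (k - j) (n + j) := by
    intro j hj
    rw [hA.mul_apply hB j n (s := Finset.Icc (k - b - c) a)
      (Finset.Icc_subset_Icc (by have := Finset.mem_Icc.mp hj; omega) le_rfl), Finset.sum_mul]
  have hi : ∀ i ∈ Finset.Icc (k - b - c) a, A i n * (B * C) (k - i) (n + i)
      = ∑ j ∈ Finset.Icc (k - c) (a + b), A i n * B (j - i) (n + i) * C (k - j) (n + j) := by
    intro i hi
    have hi' := Finset.mem_Icc.mp hi
    rw [hB.mul_apply hC (k - i) (n + i) (s := Finset.Icc (k - c - i) (a + b - i))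
      (Finset.Icc_subset_Icc (by omega) (by omega)), Finset.mul_sum]
    refine Finset.sum_nbij' (· + i) (· - i) ?_ ?_ ?_ ?_ ?_
    · intro j hj
      have := Finset.mem_Icc.mp hj
      exact Finset.mem_Icc.mpr ⟨by omega, by omega⟩
    · intro j hj
      have := Finset.mem_Icc.mp hj
      exact Finset.mem_Icc.mpr ⟨by omega, by omega⟩
    · intro j _; ring
    · intro j _; ring
    · intro j _
      rw [← _root_.mul_assoc]
      congr 2
      · congr 1; ring
      · ring
      · ring
  rw [(hA.mul hB).mul_apply hC k n subset_rfl,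
    hA.mul_apply (hB.mul hC) k n (s := Finset.Icc (k - b - c) a)
      (Finset.Icc_subset_Icc (by omega) le_rfl),
    Finset.sum_congr rfl hj, Finset.sum_congr rfl hi, Finset.sum_comm]

theorem mul_add {b : ℤ} {C : ShiftOp} (hA : OrdLE a A) (hB : OrdLE b B) (hC : OrdLE b C) :
    A * (B + C) = A * B + A * C := by
  ext k n
  rw [ShiftOp.add_apply, hA.mul_apply (hB.add hC) k n subset_rfl,
    hA.mul_apply hB k n subset_rfl, hA.mul_apply hC k n subset_rfl, ← Finset.sum_add_distrib]
  simp [_root_.mul_add]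

theorem add_mul {c : ℤ} {C : ShiftOp} (hA : OrdLE a A) (hB : OrdLE a B) (hC : OrdLE c C) :
    (A + B) * C = A * C + B * C := by
  ext k n
  rw [ShiftOp.add_apply, (hA.add hB).mul_apply hC k n subset_rfl,
    hA.mul_apply hC k n subset_rfl, hB.mul_apply hC k n subset_rfl, ← Finset.sum_add_distrib]
  simp [_root_.add_mul]

end OrdLE

theorem mulOp_ordLE (f : ℤ → ℂ) : OrdLE 0 (mulOp f) := fun j hj n => by
  simp [mulOp, hj.ne']

theorem mulOp_mul_apply (f : ℤ → ℂ) (A : ShiftOp) (k n : ℤ) : (mulOp f * A) k n = f n * A k n := by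
  rw [ShiftOp.mul_apply, finsum_eq_single _ 0 fun j hj => by simp [mulOp, hj]]
  simp [mulOp]

theorem mul_mulOp_apply (f : ℤ → ℂ) (A : ShiftOp) (k n : ℤ) :
    (A * mulOp f) k n = A k n * f (n + k) := by
  rw [ShiftOp.mul_apply, finsum_eq_single _ k fun j hj => by
    simp [mulOp, sub_eq_zero, hj.symm]]
  simp [mulOp]

theorem dyad_apply (f g : ℤ → ℂ) (k n : ℤ) :
    dyad f g k n = if k ≤ 0 then f n * g (n + k) else 0 := by
  rw [dyad, mul_mulOp_apply, mulOp_mul_apply, geom]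
  split_ifs <;> simp

theorem ShiftOp.smul_mul (c : ℂ) (A B : ShiftOp) : c • A * B = c • (A * B) := by
  ext k n
  simp only [ShiftOp.smul_apply, ShiftOp.mul_apply, mul_assoc]
  rw [mul_finsum]

theorem ShiftOp.mul_smul (c : ℂ) (A B : ShiftOp) : A * c • B = c • (A * B) := by
  ext k n
  simp only [ShiftOp.smul_apply, ShiftOp.mul_apply, mul_left_comm _ c]
  rw [mul_finsum]

/-- Shift operators of bounded order. -/
@[ext] structure BddOp where
  /-- The underlying shift operator. -/
  val : ShiftOp
  exists_ordLE : ∃ a, OrdLE a val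

namespace BddOp

theorem exists_val_eq {A : ShiftOp} (h : ∃ a, OrdLE a A) : ∃ B : BddOp, B.val = A := ⟨⟨A, h⟩, rfl⟩

theorem exists_ordLE₂ (A B : BddOp) : ∃ a, OrdLE a A.1 ∧ OrdLE a B.1 := by
  obtain ⟨a, ha⟩ := A.2
  obtain ⟨b, hb⟩ := B.2
  exact ⟨max a b, ha.mono (le_max_left _ _), hb.mono (le_max_right _ _)⟩

instance : Zero BddOp := ⟨⟨0, 0, fun _ _ _ => rfl⟩⟩
instance : One BddOp := ⟨⟨mulOp fun _ => 1, 0, mulOp_ordLE _⟩⟩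
instance : Add BddOp := ⟨fun A B => ⟨A.1 + B.1, by
  obtain ⟨a, ha, hb⟩ := exists_ordLE₂ A B
  exact ⟨a, ha.add hb⟩⟩⟩
instance : Neg BddOp := ⟨fun A => ⟨-A.1, by
  obtain ⟨a, ha⟩ := A.2
  exact ⟨a, fun j hj n => by simp [ha j hj]⟩⟩⟩
instance : Mul BddOp := ⟨fun A B => ⟨A.1 * B.1, by
  obtain ⟨a, ha, hb⟩ := exists_ordLE₂ A B
  exact ⟨a + a, ha.mul hb⟩⟩⟩

theorem val_mul (A B : BddOp) : (A * B).1 = A.1 * B.1 := rfl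
theorem val_add (A B : BddOp) : (A + B).1 = A.1 + B.1 := rfl
theorem val_neg (A : BddOp) : (-A).1 = -A.1 := rfl
theorem val_zero : (0 : BddOp).1 = 0 := rfl

protected theorem mul_add (A B C : BddOp) : A * (B + C) = A * B + A * C := by
  obtain ⟨a, ha⟩ := A.2
  obtain ⟨b, hb, hc⟩ := exists_ordLE₂ B C
  exact BddOp.ext (ha.mul_add hb hc)

protected theorem add_mul (A B C : BddOp) : (A + B) * C = A * C + B * C := by
  obtain ⟨c, hc⟩ := C.2
  obtain ⟨a, ha, hb⟩ := exists_ordLE₂ A B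
  exact BddOp.ext (ha.add_mul hb hc)

protected theorem mul_assoc (A B C : BddOp) : A * B * C = A * (B * C) := by
  obtain ⟨a, ha⟩ := A.2
  obtain ⟨b, hb⟩ := B.2
  obtain ⟨c, hc⟩ := C.2
  exact BddOp.ext (ha.mul_assoc hb hc)

/-- Commutator identities for shift operators are proved in this ring, by `noncomm_ring`, and then
read off on the underlying operators. -/
instance : Ring BddOp where
  add_assoc A B C := BddOp.ext (add_assoc A.1 B.1 C.1)
  zero_add A := BddOp.ext (zero_add A.1)
  add_zero A := BddOp.ext (add_zero A.1)
  add_comm A B := BddOp.ext (add_comm A.1 B.1)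
  neg_add_cancel A := BddOp.ext (neg_add_cancel A.1)
  left_distrib := BddOp.mul_add
  right_distrib := BddOp.add_mul
  zero_mul A := by
    have h := BddOp.add_mul 0 0 A
    ext j n
    simp [val_mul, val_zero, ShiftOp.mul_apply]
  mul_zero A := by
    ext j n
    simp [val_mul, val_zero, ShiftOp.mul_apply]
  mul_assoc := BddOp.mul_assoc
  one_mul A := by
    ext j n
    exact (mulOp_mul_apply _ _ _ _).trans (one_mul _)
  mul_one A := by
    ext j n
    exact (mul_mulOp_apply _ _ _ _).trans (mul_one _)
  nsmul := nsmulRec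
  zsmul := zsmulRec

theorem val_sub (A B : BddOp) : (A - B).1 = A.1 - B.1 := by
  rw [sub_eq_add_neg, val_add, val_neg, ← sub_eq_add_neg]

theorem val_bracket (A B : BddOp) : (A * B - B * A).1 = bracket A.1 B.1 := val_sub _ _

theorem val_pow (A : BddOp) (n : ℕ) : (A ^ n).1 = opPow A.1 n := by
  induction n with
  | zero => rw [pow_zero]; rfl
  | succ n ih => rw [pow_succ, val_mul, ih]; rfl

end BddOp

/-! ### Shift operators with coefficients in `𝒜` -/

/-- Spaces of summable sequences, used as coefficients of shift operators. -/
structure IsCoeffSpace (𝒜 : Set (ℤ → ℂ)) : Prop extends IsSeqSpace 𝒜 where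
  summable : ∀ f ∈ 𝒜, Summable fun n => ‖f n‖

theorem isCoeffSpace_L1 : IsCoeffSpace L1 := ⟨isSeqSpace_L1, fun _ hf => hf⟩

theorem isCoeffSpace_Schwartz : IsCoeffSpace Schwartz :=
  ⟨isSeqSpace_Schwartz, fun _ hf => Schwartz_subset_L1 hf⟩

/-- The coefficients of order `k` of operators in `Alg 𝒜`. -/
def Coeff (𝒜 : Set (ℤ → ℂ)) (k : ℤ) : Set (ℤ → ℂ) :=
  {a | ∃ c : ℂ, (k ≤ 0 → c = 0) ∧ (fun n => a n - c) ∈ 𝒜}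

theorem mem_coeff_of_mem {𝒜 : Set (ℤ → ℂ)} {a : ℤ → ℂ} (k : ℤ) (h : a ∈ 𝒜) : a ∈ Coeff 𝒜 k :=
  ⟨0, fun _ => rfl, by simpa using h⟩

theorem mem_of_mem_coeff {𝒜 : Set (ℤ → ℂ)} {a : ℤ → ℂ} {k : ℤ} (hk : k ≤ 0) (h : a ∈ Coeff 𝒜 k) :
    a ∈ 𝒜 := by
  obtain ⟨c, hc, h⟩ := h
  simpa [hc hk] using h

theorem mem_alg_iff {𝒜 : Set (ℤ → ℂ)} {A : ShiftOp} :
    A ∈ Alg 𝒜 ↔ (∃ M, OrdLE M A) ∧ ∀ j, A j ∈ Coeff 𝒜 j := by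
  constructor
  · rintro ⟨hM, h0, h1⟩
    refine ⟨hM, fun j => ?_⟩
    rcases le_or_gt j 0 with hj | hj
    · exact mem_coeff_of_mem j (h0 j hj)
    · obtain ⟨c, hc⟩ := h1 j hj
      exact ⟨c, fun h => absurd h hj.not_ge, hc⟩
  · rintro ⟨hM, h⟩
    exact ⟨hM, fun j hj => mem_of_mem_coeff hj (h j), fun j _ => by
      obtain ⟨c, -, hc⟩ := h j
      exact ⟨c, hc⟩⟩

theorem mem_coeff_of_mem_alg {𝒜 : Set (ℤ → ℂ)} {A : ShiftOp} (h : A ∈ Alg 𝒜) (j : ℤ) :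
    A j ∈ Coeff 𝒜 j := (mem_alg_iff.mp h).2 j

theorem ordLE_pos {a : ℤ} {A : ShiftOp} (h : OrdLE a A) : OrdLE a (pos A) := fun j hj n => by
  simp [pos, h j hj]

theorem ordLE_spos {a : ℤ} {A : ShiftOp} (h : OrdLE a A) : OrdLE a (spos A) := fun j hj n => by
  simp [spos, h j hj]

theorem ordLE_neg (A : ShiftOp) : OrdLE (-1) (neg A) := fun j hj n => by
  simp [neg, show ¬ j < 0 by omega]

theorem dyad_ordLE (f g : ℤ → ℂ) : OrdLE 0 (dyad f g) := fun j hj n => by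
  simp [dyad_apply, hj.not_ge]

namespace IsCoeffSpace

variable {𝒜 : Set (ℤ → ℂ)} (h𝒜 : IsCoeffSpace 𝒜)
include h𝒜

theorem mul_mem_of_coeff {f a : ℤ → ℂ} {k : ℤ} (hf : f ∈ 𝒜) (ha : a ∈ Coeff 𝒜 k) :
    (fun n => a n * f n) ∈ 𝒜 := by
  refine h𝒜.bdd_mul a ?_ f hf
  obtain ⟨c, -, hc⟩ := ha
  obtain ⟨C, hC⟩ := h𝒜.bdd _ hc
  refine ⟨C + ‖c‖, fun n => ?_⟩
  have h := norm_add_le (a n - c) c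
  rw [sub_add_cancel] at h
  exact h.trans (by gcongr; exact hC n)

theorem coeff_bdd {a : ℤ → ℂ} {k : ℤ} (ha : a ∈ Coeff 𝒜 k) : ∃ C : ℝ, ∀ n, ‖a n‖ ≤ C := by
  obtain ⟨c, -, hc⟩ := ha
  obtain ⟨C, hC⟩ := h𝒜.bdd _ hc
  refine ⟨C + ‖c‖, fun n => ?_⟩
  have h := norm_add_le (a n - c) c
  rw [sub_add_cancel] at h
  exact h.trans (by gcongr; exact hC n)

theorem coeff_add {a b : ℤ → ℂ} {k : ℤ} (ha : a ∈ Coeff 𝒜 k) (hb : b ∈ Coeff 𝒜 k) :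
    a + b ∈ Coeff 𝒜 k := by
  obtain ⟨c, hc, ha⟩ := ha
  obtain ⟨d, hd, hb⟩ := hb
  refine ⟨c + d, fun h => by rw [hc h, hd h, add_zero], ?_⟩
  convert h𝒜.add _ ha _ hb using 1
  ext n
  simp only [Pi.add_apply]
  ring

theorem coeff_smul (z : ℂ) {a : ℤ → ℂ} {k : ℤ} (ha : a ∈ Coeff 𝒜 k) : z • a ∈ Coeff 𝒜 k := by
  obtain ⟨c, hc, ha⟩ := ha
  refine ⟨z * c, fun h => by rw [hc h, mul_zero], ?_⟩
  convert h𝒜.smul z ha using 1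
  ext n
  simp only [Pi.smul_apply, smul_eq_mul]
  ring

theorem coeff_mul {a b : ℤ → ℂ} {j k : ℤ} (ha : a ∈ Coeff 𝒜 j) (hb : b ∈ Coeff 𝒜 (k - j)) :
    (fun n => a n * b (n + j)) ∈ Coeff 𝒜 k := by
  have hb' : (fun n => b (n + j)) ∈ Coeff 𝒜 (k - j) := by
    obtain ⟨d, hd, hb⟩ := hb
    exact ⟨d, hd, h𝒜.shift _ hb j⟩
  obtain ⟨c, hc, ha'⟩ := ha
  have hb0 := hb'
  obtain ⟨d, hd, hb''⟩ := hb'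
  -- If `k ≤ 0`, then `j` or `k - j` is nonpositive, so one of the two constants vanishes.
  refine ⟨c * d, fun h => ?_, ?_⟩
  · rcases le_or_gt j 0 with hj | hj
    · rw [hc hj, zero_mul]
    · rw [hd (by omega), mul_zero]
  · convert h𝒜.add _ (h𝒜.mul_mem_of_coeff ha' hb0) _ (h𝒜.smul c hb'') using 1
    ext n
    simp only [Pi.add_apply, Pi.smul_apply, smul_eq_mul]
    ring

theorem alg_add {A B : ShiftOp} (hA : A ∈ Alg 𝒜) (hB : B ∈ Alg 𝒜) : A + B ∈ Alg 𝒜 := by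
  rw [mem_alg_iff] at *
  obtain ⟨⟨a, ha⟩, hA⟩ := hA
  obtain ⟨⟨b, hb⟩, hB⟩ := hB
  exact ⟨⟨max a b, (ha.mono (le_max_left _ _)).add (hb.mono (le_max_right _ _))⟩,
    fun j => h𝒜.coeff_add (hA j) (hB j)⟩

theorem alg_smul (c : ℂ) {A : ShiftOp} (hA : A ∈ Alg 𝒜) : c • A ∈ Alg 𝒜 := by
  rw [mem_alg_iff] at *
  obtain ⟨⟨a, ha⟩, hA⟩ := hA
  exact ⟨⟨a, fun j hj n => by simp [ha j hj]⟩, fun j => h𝒜.coeff_smul c (hA j)⟩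

theorem alg_neg {A : ShiftOp} (hA : A ∈ Alg 𝒜) : -A ∈ Alg 𝒜 := by
  simpa using h𝒜.alg_smul (-1) hA

theorem alg_sub {A B : ShiftOp} (hA : A ∈ Alg 𝒜) (hB : B ∈ Alg 𝒜) : A - B ∈ Alg 𝒜 := by
  rw [sub_eq_add_neg]
  exact h𝒜.alg_add hA (h𝒜.alg_neg hB)

theorem alg_zero : (0 : ShiftOp) ∈ Alg 𝒜 :=
  ⟨⟨0, fun _ _ _ => rfl⟩, fun _ _ => h𝒜.zero, fun _ _ => ⟨0, by simpa using! h𝒜.zero⟩⟩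

theorem alg_sum {ι : Type*} (s : Finset ι) {A : ι → ShiftOp} (hA : ∀ i ∈ s, A i ∈ Alg 𝒜) :
    ∑ i ∈ s, A i ∈ Alg 𝒜 :=
  Finset.sum_induction A (· ∈ Alg 𝒜) (fun _ _ => h𝒜.alg_add) h𝒜.alg_zero hA

theorem alg_mul {A B : ShiftOp} (hA : A ∈ Alg 𝒜) (hB : B ∈ Alg 𝒜) : A * B ∈ Alg 𝒜 := by
  rw [mem_alg_iff] at *
  obtain ⟨⟨a, ha⟩, hA⟩ := hA
  obtain ⟨⟨b, hb⟩, hB⟩ := hB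
  refine ⟨⟨_, ha.mul hb⟩, fun k => ?_⟩
  have h : (A * B) k = ∑ j ∈ Finset.Icc (k - b) a, fun n => A j n * B (k - j) (n + j) := by
    ext n
    rw [ha.mul_apply hb k n subset_rfl, Finset.sum_apply]
  rw [h]
  exact Finset.sum_induction _ (· ∈ Coeff 𝒜 k) (fun _ _ => h𝒜.coeff_add)
    (mem_coeff_of_mem k h𝒜.zero) fun j _ => h𝒜.coeff_mul (hA j) (hB (k - j))

/-- The operators without constant parts form an ideal of `Alg 𝒜`; this half and `coeff_mul_mem` are
applied to negative parts. -/
theorem mul_coeff_mem {A B : ShiftOp} (hA : A ∈ Alg 𝒜) (hB : B ∈ Alg 𝒜) (hB' : ∀ j, B j ∈ 𝒜)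
    (k : ℤ) : (A * B) k ∈ 𝒜 := by
  obtain ⟨⟨a, ha⟩, hA⟩ := mem_alg_iff.mp hA
  obtain ⟨⟨b, hb⟩, -⟩ := mem_alg_iff.mp hB
  have h : (A * B) k = ∑ j ∈ Finset.Icc (k - b) a, fun n => A j n * B (k - j) (n + j) := by
    ext n
    rw [ha.mul_apply hb k n subset_rfl, Finset.sum_apply]
  rw [h]
  exact h𝒜.sum _ fun j _ => h𝒜.mul_mem_of_coeff (h𝒜.shift _ (hB' (k - j)) j) (hA j)

theorem coeff_mul_mem {A B : ShiftOp} (hA : A ∈ Alg 𝒜) (hA' : ∀ j, A j ∈ 𝒜) (hB : B ∈ Alg 𝒜)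
    (k : ℤ) : (A * B) k ∈ 𝒜 := by
  obtain ⟨⟨a, ha⟩, -⟩ := mem_alg_iff.mp hA
  obtain ⟨⟨b, hb⟩, hB⟩ := mem_alg_iff.mp hB
  have h : (A * B) k = ∑ j ∈ Finset.Icc (k - b) a, fun n => B (k - j) (n + j) * A j n := by
    ext n
    rw [ha.mul_apply hb k n subset_rfl, Finset.sum_apply]
    simp [mul_comm]
  rw [h]
  refine h𝒜.sum _ fun j _ => h𝒜.bdd_mul _ ?_ _ (hA' j)
  obtain ⟨C, hC⟩ := h𝒜.coeff_bdd (hB (k - j))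
  exact ⟨C, fun n => hC _⟩

theorem alg_bracket {A B : ShiftOp} (hA : A ∈ Alg 𝒜) (hB : B ∈ Alg 𝒜) : bracket A B ∈ Alg 𝒜 :=
  h𝒜.alg_sub (h𝒜.alg_mul hA hB) (h𝒜.alg_mul hB hA)

/-- Common to all truncations, which keep or delete whole coefficients. -/
theorem alg_of_coeff {A B : ShiftOp} (hA : A ∈ Alg 𝒜)
    (h : ∀ j, (∀ n, B j n = A j n) ∨ ∀ n, B j n = 0) : B ∈ Alg 𝒜 := by
  rw [mem_alg_iff] at *
  obtain ⟨⟨a, ha⟩, hA⟩ := hA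
  refine ⟨⟨a, fun j hj n => ?_⟩, fun j => ?_⟩
  · rcases h j with h | h
    · rw [h, ha j hj]
    · exact h n
  · rcases h j with h | h
    · rw [show B j = A j from funext h]
      exact hA j
    · rw [show B j = 0 from funext h]
      exact mem_coeff_of_mem j h𝒜.zero

theorem alg_pos {A : ShiftOp} (hA : A ∈ Alg 𝒜) : pos A ∈ Alg 𝒜 :=
  h𝒜.alg_of_coeff hA fun j => by
    by_cases hj : 0 ≤ j
    · left; simp [pos, hj]
    · right; simp [pos, hj]

theorem alg_spos {A : ShiftOp} (hA : A ∈ Alg 𝒜) : spos A ∈ Alg 𝒜 :=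
  h𝒜.alg_of_coeff hA fun j => by
    by_cases hj : 0 < j
    · left; simp [spos, hj]
    · right; simp [spos, hj]

theorem alg_negPart {A : ShiftOp} (hA : A ∈ Alg 𝒜) : ShiftLax.neg A ∈ Alg 𝒜 :=
  h𝒜.alg_of_coeff hA fun j => by
    by_cases hj : j < 0
    · left; simp [ShiftLax.neg, hj]
    · right; simp [ShiftLax.neg, hj]

theorem negPart_coeff_mem {A : ShiftOp} (hA : A ∈ Alg 𝒜) (j : ℤ) : ShiftLax.neg A j ∈ 𝒜 := by
  rcases le_or_gt j 0 with hj | hj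
  · exact mem_of_mem_coeff hj (mem_coeff_of_mem_alg (h𝒜.alg_negPart hA) j)
  · rw [show ShiftLax.neg A j = 0 from funext (ordLE_neg A j (by omega))]
    exact h𝒜.zero

/-- The exponent `0` is excluded because the identity has a nonzero constant in order `0` and is not
in `Alg 𝒜`. -/
theorem alg_opPow {A : ShiftOp} (hA : A ∈ Alg 𝒜) {n : ℕ} (hn : 1 ≤ n) : opPow A n ∈ Alg 𝒜 := by
  induction n, hn using Nat.le_induction with
  | base =>
    convert hA using 1
    ext j n
    exact (mulOp_mul_apply _ _ _ _).trans (one_mul _)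
  | succ n _ ih => exact h𝒜.alg_mul ih hA

/-! ### The trace -/

theorem summable_coeff_zero {A : ShiftOp} (hA : A ∈ Alg 𝒜) : Summable fun n => ‖A 0 n‖ :=
  h𝒜.summable _ (mem_of_mem_coeff le_rfl (mem_coeff_of_mem_alg hA 0))

theorem tr_add {A B : ShiftOp} (hA : A ∈ Alg 𝒜) (hB : B ∈ Alg 𝒜) : tr (A + B) = tr A + tr B :=
  (h𝒜.summable_coeff_zero hA).of_norm.tsum_add (h𝒜.summable_coeff_zero hB).of_norm

omit h𝒜 in
theorem _root_.ShiftLax.tr_smul (c : ℂ) (A : ShiftOp) : tr (c • A) = c * tr A := tsum_mul_left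

/-- One of the orders `j`, `-j` is nonpositive, so one factor is summable while the other is
bounded. -/
theorem summable_mul {A B : ShiftOp} (hA : A ∈ Alg 𝒜) (hB : B ∈ Alg 𝒜) (j : ℤ) :
    Summable fun n => A j n * B (-j) (n + j) := by
  have h := h𝒜.coeff_mul (k := 0) (mem_coeff_of_mem_alg hA j)
    (by rw [zero_sub]; exact mem_coeff_of_mem_alg hB (-j))
  exact (h𝒜.summable _ (mem_of_mem_coeff le_rfl h)).of_norm

theorem form_eq {A B : ShiftOp} (hA : A ∈ Alg 𝒜) (hB : B ∈ Alg 𝒜) {a b : ℤ} (ha : OrdLE a A)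
    (hb : OrdLE b B) :
    form A B = ∑ j ∈ Finset.Icc (-b) a, ∑' n, A j n * B (-j) (n + j) := by
  rw [form, tr, ← Summable.tsum_finsetSum fun j _ => h𝒜.summable_mul hA hB j]
  refine tsum_congr fun n => ?_
  rw [ha.mul_apply hb 0 n (s := Finset.Icc (-b) a) (by simp)]
  simp

/-- Order `j` of `A` meets order `-j` of `B`; the two resulting series differ by a translation of
`n`. -/
theorem form_comm {A B : ShiftOp} (hA : A ∈ Alg 𝒜) (hB : B ∈ Alg 𝒜) : form A B = form B A := by
  obtain ⟨⟨a, ha⟩, -⟩ := mem_alg_iff.mp hA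
  obtain ⟨⟨b, hb⟩, -⟩ := mem_alg_iff.mp hB
  rw [h𝒜.form_eq hA hB ha hb, h𝒜.form_eq hB hA hb ha]
  refine Finset.sum_nbij' (-·) (-·) ?_ ?_ ?_ ?_ ?_
  · intro j hj
    have := Finset.mem_Icc.mp hj
    exact Finset.mem_Icc.mpr ⟨by omega, by omega⟩
  · intro j hj
    have := Finset.mem_Icc.mp hj
    exact Finset.mem_Icc.mpr ⟨by omega, by omega⟩
  · intro j _; exact neg_neg j
  · intro j _; exact neg_neg j
  · intro j _
    rw [← (Equiv.addRight (-j)).tsum_eq]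
    refine tsum_congr fun n => ?_
    simp [mul_comm]

theorem form_add_right {A B C : ShiftOp} (hA : A ∈ Alg 𝒜) (hB : B ∈ Alg 𝒜) (hC : C ∈ Alg 𝒜) :
    form A (B + C) = form A B + form A C := by
  obtain ⟨A, rfl⟩ := BddOp.exists_val_eq hA.1
  obtain ⟨B, rfl⟩ := BddOp.exists_val_eq hB.1
  obtain ⟨C, rfl⟩ := BddOp.exists_val_eq hC.1
  rw [form, form, form, ← h𝒜.tr_add (h𝒜.alg_mul hA hB) (h𝒜.alg_mul hA hC)]
  exact congrArg (fun D : BddOp => tr D.val) (mul_add A B C)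

theorem form_add_left {A B C : ShiftOp} (hA : A ∈ Alg 𝒜) (hB : B ∈ Alg 𝒜) (hC : C ∈ Alg 𝒜) :
    form (A + B) C = form A C + form B C := by
  rw [h𝒜.form_comm (h𝒜.alg_add hA hB) hC, h𝒜.form_add_right hC hA hB, h𝒜.form_comm hC hA,
    h𝒜.form_comm hC hB]

omit h𝒜 in
theorem _root_.ShiftLax.form_smul_right (c : ℂ) (A B : ShiftOp) :
    form A (c • B) = c * form A B := by
  rw [form, ShiftOp.mul_smul, tr_smul, form]

omit h𝒜 in
theorem _root_.ShiftLax.form_smul_left (c : ℂ) (A B : ShiftOp) :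
    form (c • A) B = c * form A B := by
  rw [form, ShiftOp.smul_mul, tr_smul, form]

omit h𝒜 in
theorem _root_.ShiftLax.form_neg_right (A B : ShiftOp) : form A (-B) = -form A B := by
  simpa using form_smul_right (-1) A B

theorem form_sub_right {A B C : ShiftOp} (hA : A ∈ Alg 𝒜) (hB : B ∈ Alg 𝒜) (hC : C ∈ Alg 𝒜) :
    form A (B - C) = form A B - form A C := by
  rw [sub_eq_add_neg, h𝒜.form_add_right hA hB (h𝒜.alg_neg hC), form_neg_right, sub_eq_add_neg]

theorem form_add_sum {ι : Type*} (s : Finset ι) {r l : ShiftOp} (hr : r ∈ Alg 𝒜)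
    (hl : l ∈ Alg 𝒜) {D : ι → ShiftOp} (hD : ∀ i, D i ∈ Alg 𝒜) :
    form r (l + ∑ i ∈ s, D i) = form r l + ∑ i ∈ s, form r (D i) := by
  classical
  induction s using Finset.induction_on with
  | empty => simp
  | insert i s hi ih =>
    rw [Finset.sum_insert hi, Finset.sum_insert hi, add_left_comm, h𝒜.form_add_right hr (hD i)
      (h𝒜.alg_add hl (h𝒜.alg_sum s fun i _ => hD i)), ih]
    ring

/-- Cyclicity of the trace, from symmetry of the form and associativity. -/
theorem form_mul {A B C : ShiftOp} (hA : A ∈ Alg 𝒜) (hB : B ∈ Alg 𝒜) (hC : C ∈ Alg 𝒜) :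
    form A (B * C) = form B (C * A) := by
  have h : form A (B * C) = form (B * C) A := h𝒜.form_comm hA (h𝒜.alg_mul hB hC)
  rw [h, form, form]
  obtain ⟨⟨a, ha⟩, -⟩ := mem_alg_iff.mp hA
  obtain ⟨⟨b, hb⟩, -⟩ := mem_alg_iff.mp hB
  obtain ⟨⟨c, hc⟩, -⟩ := mem_alg_iff.mp hC
  rw [hb.mul_assoc hc ha]

theorem form_bracket {A B C : ShiftOp} (hA : A ∈ Alg 𝒜) (hB : B ∈ Alg 𝒜) (hC : C ∈ Alg 𝒜) :
    form A (bracket B C) = form B (bracket C A) := by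
  rw [bracket, bracket, h𝒜.form_sub_right hA (h𝒜.alg_mul hB hC) (h𝒜.alg_mul hC hB),
    h𝒜.form_sub_right hB (h𝒜.alg_mul hC hA) (h𝒜.alg_mul hA hC), h𝒜.form_mul hA hB hC,
    h𝒜.form_mul hB hA hC]

/-- The form pairs order `j` with order `-j`, so the positive orders of `B` meet exactly the
negative orders of `A`. -/
theorem form_spos {A B : ShiftOp} (hA : A ∈ Alg 𝒜) (hB : B ∈ Alg 𝒜) :
    form A (spos B) = form (ShiftLax.neg A) B := by
  obtain ⟨⟨a, ha⟩, -⟩ := mem_alg_iff.mp hA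
  obtain ⟨⟨b, hb⟩, -⟩ := mem_alg_iff.mp hB
  have ha' : OrdLE a (ShiftLax.neg A) := fun j hj n => by simp [ShiftLax.neg, ha j hj]
  rw [h𝒜.form_eq hA (h𝒜.alg_spos hB) ha (ordLE_spos hb),
    h𝒜.form_eq (h𝒜.alg_negPart hA) hB ha' hb]
  refine Finset.sum_congr rfl fun j _ => tsum_congr fun n => ?_
  by_cases hj : j < 0 <;> simp [spos, ShiftLax.neg, hj]

end IsCoeffSpace

/-! ### The `r`-bracket and its Lie–Poisson operator -/

theorem pos_apply (A : ShiftOp) (j n : ℤ) : pos A j n = if 0 ≤ j then A j n else 0 := rfl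
theorem neg_apply (A : ShiftOp) (j n : ℤ) : neg A j n = if j < 0 then A j n else 0 := rfl

theorem pos_add_neg (A : ShiftOp) : pos A + neg A = A := by
  ext j n
  by_cases hj : 0 ≤ j <;> simp [pos, neg, hj]

/-- The bracket of the `r`-matrix `(P_+ - P_-) / 2`. -/
def rBracket (A B : ShiftOp) : ShiftOp := bracket (pos A) (pos B) - bracket (neg A) (neg B)

theorem bracket_neg_eq (A B : ShiftOp) : bracket B A = -bracket A B := by
  rw [bracket, bracket, neg_sub]

theorem rBracket_swap (A B : ShiftOp) : rBracket B A = -rBracket A B := by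
  rw [rBracket, rBracket, bracket_neg_eq (pos A), bracket_neg_eq (neg A)]
  abel

theorem pos_mul_pos_apply (A B : ShiftOp) {j : ℤ} (hj : j < 0) (n : ℤ) :
    (pos A * pos B) j n = 0 := by
  rw [ShiftOp.mul_apply]
  refine finsum_eq_zero_of_forall_eq_zero fun i => ?_
  by_cases hi : 0 ≤ i
  · rw [pos_apply B, if_neg (by omega), mul_zero]
  · simp [pos, hi]

theorem bracket_pos_apply (A B : ShiftOp) {j : ℤ} (hj : j < 0) (n : ℤ) :
    bracket (pos A) (pos B) j n = 0 := by
  simp [bracket, pos_mul_pos_apply, hj]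

theorem bracket_neg_apply (A B : ShiftOp) {j : ℤ} (hj : 0 ≤ j) (n : ℤ) :
    bracket (neg A) (neg B) j n = 0 :=
  (ordLE_neg A).bracket (ordLE_neg B) j (by omega) n

/-- The commutator of positive parts has only orders `≥ 0` and that of negative parts only orders `<
0`. So `r ↦ r_+` is a homomorphism from the `r`-bracket to the commutator. -/
theorem pos_rBracket (A B : ShiftOp) : pos (rBracket A B) = bracket (pos A) (pos B) := by
  ext j n
  rw [pos_apply]
  split_ifs with hj
  · rw [rBracket, ShiftOp.sub_apply, bracket_neg_apply A B hj, sub_zero]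
  · rw [bracket_pos_apply A B (not_le.mp hj)]

theorem neg_rBracket (A B : ShiftOp) : neg (rBracket A B) = -bracket (neg A) (neg B) := by
  ext j n
  rw [neg_apply, ShiftOp.neg_apply]
  split_ifs with hj
  · rw [rBracket, ShiftOp.sub_apply, bracket_pos_apply A B hj, zero_sub]
  · rw [bracket_neg_apply A B (not_lt.mp hj), neg_zero]

theorem bracket_jacobi {A B C : ShiftOp} (hA : ∃ a, OrdLE a A) (hB : ∃ a, OrdLE a B)
    (hC : ∃ a, OrdLE a C) :
    bracket (bracket A B) C + bracket (bracket B C) A + bracket (bracket C A) B = 0 := by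
  obtain ⟨A, rfl⟩ := BddOp.exists_val_eq hA
  obtain ⟨B, rfl⟩ := BddOp.exists_val_eq hB
  obtain ⟨C, rfl⟩ := BddOp.exists_val_eq hC
  have h : ((A * B - B * A) * C - C * (A * B - B * A)) + ((B * C - C * B) * A - A * (B * C - C * B))
    + ((C * A - A * C) * B - B * (C * A - A * C)) = 0 := by noncomm_ring
  have h' := congrArg BddOp.val h
  simpa only [BddOp.val_add, BddOp.val_bracket, BddOp.val_zero] using h'

theorem neg_bracket_left (A B : ShiftOp) : bracket (-A) B = -bracket A B := by
  have h : -A = (-1 : ℂ) • A := by simp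
  rw [bracket, h, ShiftOp.smul_mul, ShiftOp.mul_smul, ← smul_sub, neg_one_smul, bracket]

/-- The identity splits into the Jacobi identities of the two halves; on the negative half the sign
of the bracket enters twice and cancels. -/
theorem rBracket_jacobi {A B C : ShiftOp} (hA : ∃ a, OrdLE a A) (hB : ∃ a, OrdLE a B)
    (hC : ∃ a, OrdLE a C) :
    rBracket (rBracket A B) C + rBracket (rBracket B C) A + rBracket (rBracket C A) B = 0 := by
  have hp : ∀ {X}, (∃ a, OrdLE a X) → ∃ a, OrdLE a (pos X) := fun ⟨a, ha⟩ => ⟨a, ordLE_pos ha⟩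
  have hn : ∀ X, ∃ a, OrdLE a (neg X) := fun X => ⟨-1, ordLE_neg X⟩
  have h1 := bracket_jacobi (hp hA) (hp hB) (hp hC)
  have h2 := bracket_jacobi (hn A) (hn B) (hn C)
  simp only [rBracket.eq_1 (rBracket _ _), pos_rBracket, neg_rBracket, neg_bracket_left]
  calc _ = (bracket (bracket (pos A) (pos B)) (pos C) + bracket (bracket (pos B) (pos C)) (pos A)
        + bracket (bracket (pos C) (pos A)) (pos B))
      + (bracket (bracket (neg A) (neg B)) (neg C) + bracket (bracket (neg B) (neg C)) (neg A)
        + bracket (bracket (neg C) (neg A)) (neg B)) := by abel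
    _ = 0 := by rw [h1, h2, add_zero]

theorem rBracket_jacobi_right {A B C : ShiftOp} (hA : ∃ a, OrdLE a A) (hB : ∃ a, OrdLE a B)
    (hC : ∃ a, OrdLE a C) :
    rBracket A (rBracket C B) + rBracket B (rBracket A C) + rBracket C (rBracket B A) = 0 := by
  rw [rBracket_swap (rBracket C B), rBracket_swap (rBracket A C), rBracket_swap (rBracket B A),
    ← neg_add, ← neg_add, neg_eq_zero, add_right_comm]
  exact rBracket_jacobi hC hB hA

theorem IsCoeffSpace.alg_rBracket {𝒜 : Set (ℤ → ℂ)} (h𝒜 : IsCoeffSpace 𝒜) {A B : ShiftOp}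
    (hA : A ∈ Alg 𝒜) (hB : B ∈ Alg 𝒜) : rBracket A B ∈ Alg 𝒜 :=
  h𝒜.alg_sub (h𝒜.alg_bracket (h𝒜.alg_pos hA) (h𝒜.alg_pos hB))
    (h𝒜.alg_bracket (h𝒜.alg_negPart hA) (h𝒜.alg_negPart hB))

theorem IsCoeffSpace.alg_thetaOp {𝒜 : Set (ℤ → ℂ)} (h𝒜 : IsCoeffSpace 𝒜) {A B : ShiftOp}
    (hA : A ∈ Alg 𝒜) (hB : B ∈ Alg 𝒜) : thetaOp A B ∈ Alg 𝒜 :=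
  h𝒜.alg_sub (h𝒜.alg_bracket hA (h𝒜.alg_pos hB)) (h𝒜.alg_spos (h𝒜.alg_bracket hA hB))

/-- `thetaOp` is the Lie–Poisson operator of the `r`-bracket. -/
theorem IsCoeffSpace.form_thetaOp {𝒜 : Set (ℤ → ℂ)} (h𝒜 : IsCoeffSpace 𝒜) {l r s : ShiftOp}
    (hl : l ∈ Alg 𝒜) (hr : r ∈ Alg 𝒜) (hs : s ∈ Alg 𝒜) :
    form r (thetaOp l s) = form (rBracket s r) l := by
  have hsp := h𝒜.alg_pos hs
  have hrn := h𝒜.alg_negPart hr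
  rw [thetaOp, h𝒜.form_sub_right hr (h𝒜.alg_bracket hl hsp) (h𝒜.alg_spos (h𝒜.alg_bracket hl hs)),
    h𝒜.form_spos hr (h𝒜.alg_bracket hl hs), h𝒜.form_bracket hr hl hsp,
    h𝒜.form_bracket hrn hl hs, ← h𝒜.form_sub_right hl (h𝒜.alg_bracket hsp hr)
    (h𝒜.alg_bracket hs hrn), h𝒜.form_comm (h𝒜.alg_rBracket hs hr) hl]
  congr 1
  obtain ⟨a, ha⟩ := hr.1
  obtain ⟨b, hb⟩ := hs.1
  let rp : BddOp := ⟨pos r, a, ordLE_pos ha⟩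
  let rn : BddOp := ⟨ShiftLax.neg r, -1, ordLE_neg r⟩
  let sp : BddOp := ⟨pos s, b, ordLE_pos hb⟩
  let sn : BddOp := ⟨ShiftLax.neg s, -1, ordLE_neg s⟩
  -- After invariance of the form, what remains is `[s_+, r] - [s, r_-] = [s_+, r_+] - [s_-, r_-]`:
  -- the mixed terms `[s_+, r_-]` cancel.
  have h : (sp * (rp + rn) - (rp + rn) * sp) - ((sp + sn) * rn - rn * (sp + sn))
      = (sp * rp - rp * sp) - (sn * rn - rn * sn) := by noncomm_ring
  have hval := congrArg BddOp.val h
  have hr' : (rp + rn).1 = r := pos_add_neg r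
  have hs' : (sp + sn).1 = s := pos_add_neg s
  rw [BddOp.val_sub, BddOp.val_sub (sp * rp - rp * sp)] at hval
  simp only [BddOp.val_bracket, hr', hs'] at hval
  exact hval

/-! ### Operators of finite order on both sides and their action on sequences -/

/-- Only the orders `|j| ≤ m` occur in `A`. -/
def FinOrd (m : ℤ) (A : ShiftOp) : Prop := ∀ j, m < |j| → ∀ n, A j n = 0

namespace FinOrd

variable {m k : ℤ} {A B : ShiftOp}

theorem mono (hA : FinOrd m A) (h : m ≤ k) : FinOrd k A := fun j hj n => hA j (h.trans_lt hj) n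

theorem ordLE (hA : FinOrd m A) : OrdLE m A := fun j hj n => hA j (hj.trans_le (le_abs_self j)) n

/-- The bound on orders is symmetric so that the adjoint, which reverses them, has the same bound.
-/
theorem adj (hA : FinOrd m A) : FinOrd m (adj A) := fun j hj n => hA (-j) (by rwa [abs_neg]) _

theorem smul (c : ℂ) (hA : FinOrd m A) : FinOrd m (c • A) := fun j hj n => by simp [hA j hj]

theorem mul_apply (hA : FinOrd m A) (B : ShiftOp) (k n : ℤ) :
    (A * B) k n = ∑ j ∈ Finset.Icc (-m) m, A j n * B (k - j) (n + j) := by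
  refine finsum_eq_sum_of_support_subset _ fun j hj => ?_
  refine Finset.mem_coe.mpr (Finset.mem_Icc.mpr (abs_le.mp ?_))
  by_contra h
  exact Function.mem_support.mp hj (by rw [hA j (not_le.mp h), zero_mul])

theorem act_apply (hA : FinOrd m A) (f : ℤ → ℂ) (n : ℤ) :
    act A f n = ∑ j ∈ Finset.Icc (-m) m, A j n * f (n + j) := by
  refine finsum_eq_sum_of_support_subset _ fun j hj => ?_
  refine Finset.mem_coe.mpr (Finset.mem_Icc.mpr (abs_le.mp ?_))
  by_contra h
  exact Function.mem_support.mp hj (by rw [hA j (not_le.mp h), zero_mul])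

theorem mul (hA : FinOrd m A) (hB : FinOrd k B) : FinOrd (m + k) (A * B) := fun i hi n => by
  rw [hA.mul_apply]
  refine Finset.sum_eq_zero fun j hj => ?_
  have h1 := abs_le.mpr (Finset.mem_Icc.mp hj)
  have h2 := abs_add_le j (i - j)
  rw [add_sub_cancel] at h2
  rw [hB _ (by omega), mul_zero]

theorem act_add_op (hA : FinOrd m A) (hB : FinOrd k B) (f : ℤ → ℂ) :
    act (A + B) f = act A f + act B f := by
  ext n
  have hA' := hA.mono (le_max_left m k)
  have hB' := hB.mono (le_max_right m k)
  have hAB : FinOrd (max m k) (A + B) := fun j hj n => by simp [hA' j hj, hB' j hj]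
  rw [Pi.add_apply, hA'.act_apply, hB'.act_apply, hAB.act_apply, ← Finset.sum_add_distrib]
  simp [add_mul]

theorem act_sub_op (hA : FinOrd m A) (hB : FinOrd k B) (f : ℤ → ℂ) :
    act (A - B) f = act A f - act B f := by
  ext n
  have hA' := hA.mono (le_max_left m k)
  have hB' := hB.mono (le_max_right m k)
  have hAB : FinOrd (max m k) (A - B) := fun j hj n => by simp [hA' j hj, hB' j hj]
  rw [Pi.sub_apply, hA'.act_apply, hB'.act_apply, hAB.act_apply, ← Finset.sum_sub_distrib]
  simp [sub_mul]

theorem act_sub (hA : FinOrd m A) (f g : ℤ → ℂ) : act A (f - g) = act A f - act A g := by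
  ext n
  rw [Pi.sub_apply, hA.act_apply, hA.act_apply, hA.act_apply, ← Finset.sum_sub_distrib]
  simp [mul_sub]

/-- Both sides are one double sum once the inner sums are extended by zeros to the range `|j| ≤ m +
k`. -/
theorem act_mul (hA : FinOrd m A) (hB : FinOrd k B) (f : ℤ → ℂ) :
    act (A * B) f = act A (act B f) := by
  ext n
  have hi : ∀ i ∈ Finset.Icc (-m) m, A i n * act B f (n + i)
      = ∑ j ∈ Finset.Icc (-(m + k)) (m + k), A i n * B (j - i) (n + i) * f (n + j) := by
    intro i hi
    have hi' := Finset.mem_Icc.mp hi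
    rw [hB.act_apply, Finset.mul_sum]
    have hsub : Finset.Icc (-k + i) (k + i) ⊆ Finset.Icc (-(m + k)) (m + k) :=
      Finset.Icc_subset_Icc (by omega) (by omega)
    rw [← Finset.sum_subset hsub]
    · refine Finset.sum_nbij' (· + i) (· - i) ?_ ?_ ?_ ?_ ?_
      · intro j hj
        have := Finset.mem_Icc.mp hj
        exact Finset.mem_Icc.mpr ⟨by omega, by omega⟩
      · intro j hj
        have := Finset.mem_Icc.mp hj
        exact Finset.mem_Icc.mpr ⟨by omega, by omega⟩
      · intro j _; ring
      · intro j _; ring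
      · intro j _
        rw [← mul_assoc]
        congr 2
        · congr 1; ring
        · ring
    · intro j _ hj
      have : k < |j - i| := by
        by_contra h
        have := abs_le.mp (not_lt.mp h)
        exact hj (Finset.mem_Icc.mpr ⟨by omega, by omega⟩)
      rw [hB _ this, mul_zero, zero_mul]
  rw [hA.act_apply, Finset.sum_congr rfl hi, (hA.mul hB).act_apply, Finset.sum_comm]
  refine Finset.sum_congr rfl fun j _ => ?_
  rw [hA.mul_apply, Finset.sum_mul]

end FinOrd

theorem act_smul_op (c : ℂ) (A : ShiftOp) (f : ℤ → ℂ) : act (c • A) f = c • act A f := by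
  ext n
  rw [Pi.smul_apply, act, act, smul_eq_mul, mul_finsum]
  simp [mul_assoc]

/-- A bijective change of index matches the two sums term by term, so no finiteness is needed. -/
theorem adj_mul (A B : ShiftOp) : adj (A * B) = adj B * adj A := by
  ext j n
  rw [adj, ShiftOp.mul_apply, ShiftOp.mul_apply, ← finsum_comp_equiv (Equiv.subRight j)]
  refine finsum_congr fun i => ?_
  rw [mul_comm, adj, adj]
  simp only [Equiv.subRight_apply]
  congr 2 <;> ring_nf

theorem adj_sub (A B : ShiftOp) : adj (A - B) = adj A - adj B := rfl
theorem adj_add (A B : ShiftOp) : adj (A + B) = adj A + adj B := rfl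
theorem adj_smul (c : ℂ) (A : ShiftOp) : adj (c • A) = c • adj A := rfl

theorem pos_add (A B : ShiftOp) : pos (A + B) = pos A + pos B := by
  ext j n
  by_cases hj : 0 ≤ j <;> simp [pos_apply, hj]

theorem pos_smul (c : ℂ) (A : ShiftOp) : pos (c • A) = c • pos A := by
  ext j n
  by_cases hj : 0 ≤ j <;> simp [pos_apply, hj]

theorem exists_finOrd_pos {A : ShiftOp} (hA : ∃ a, OrdLE a A) : ∃ m, FinOrd m (pos A) := by
  obtain ⟨a, ha⟩ := hA
  refine ⟨a, fun j hj n => ?_⟩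
  rw [pos_apply]
  split_ifs with h
  · exact ha j (by rwa [abs_of_nonneg h] at hj) n
  · rfl

/-- Sequences carry a representation of the `r`-bracket through `r ↦ r_+`. -/
theorem act_pos_rBracket {A B : ShiftOp} (hA : ∃ a, OrdLE a A) (hB : ∃ a, OrdLE a B)
    (f : ℤ → ℂ) : act (pos (rBracket A B)) f
      = act (pos A) (act (pos B) f) - act (pos B) (act (pos A) f) := by
  obtain ⟨a, ha⟩ := exists_finOrd_pos hA
  obtain ⟨b, hb⟩ := exists_finOrd_pos hB
  rw [pos_rBracket, bracket, (ha.mul hb).act_sub_op (hb.mul ha), ha.act_mul hb, hb.act_mul ha]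

/-- The dual representation is `r ↦ -r_+^*`; without the sign the order of the factors is reversed.
-/
theorem act_adj_pos_rBracket {A B : ShiftOp} (hA : ∃ a, OrdLE a A) (hB : ∃ a, OrdLE a B)
    (f : ℤ → ℂ) : act (adj (pos (rBracket A B))) f
      = act (adj (pos B)) (act (adj (pos A)) f) - act (adj (pos A)) (act (adj (pos B)) f) := by
  obtain ⟨a, ha⟩ := exists_finOrd_pos hA
  obtain ⟨b, hb⟩ := exists_finOrd_pos hB
  rw [pos_rBracket, bracket, adj_sub, adj_mul, adj_mul,
    (hb.adj.mul ha.adj).act_sub_op (ha.adj.mul hb.adj), hb.adj.act_mul ha.adj,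
    ha.adj.act_mul hb.adj]

theorem IsSeqSpace.act_mem {𝒲 : Set (ℤ → ℂ)} (h𝒲 : IsSeqSpace 𝒲) {m : ℤ} {A : ShiftOp}
    (hA : FinOrd m A) (hb : ∀ j, ∃ C : ℝ, ∀ n, ‖A j n‖ ≤ C) {f : ℤ → ℂ} (hf : f ∈ 𝒲) :
    act A f ∈ 𝒲 := by
  have h : act A f = ∑ j ∈ Finset.Icc (-m) m, fun n => A j n * f (n + j) := by
    ext n
    rw [hA.act_apply, Finset.sum_apply]
  rw [h]
  exact h𝒲.sum _ fun j _ => h𝒲.bdd_mul _ (hb j) _ (h𝒲.shift f hf j)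

theorem IsCoeffSpace.act_pos_mem {𝒜 𝒲 : Set (ℤ → ℂ)} (h𝒜 : IsCoeffSpace 𝒜) (h𝒲 : IsSeqSpace 𝒲)
    {A : ShiftOp} (hA : A ∈ Alg 𝒜) {f : ℤ → ℂ} (hf : f ∈ 𝒲) : act (pos A) f ∈ 𝒲 := by
  obtain ⟨a, ha⟩ := exists_finOrd_pos hA.1
  exact h𝒲.act_mem ha (fun j => h𝒜.coeff_bdd (mem_coeff_of_mem_alg (h𝒜.alg_pos hA) j)) hf

theorem IsCoeffSpace.act_adj_pos_mem {𝒜 𝒲 : Set (ℤ → ℂ)} (h𝒜 : IsCoeffSpace 𝒜)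
    (h𝒲 : IsSeqSpace 𝒲) {A : ShiftOp} (hA : A ∈ Alg 𝒜) {f : ℤ → ℂ} (hf : f ∈ 𝒲) :
    act (adj (pos A)) f ∈ 𝒲 := by
  obtain ⟨a, ha⟩ := exists_finOrd_pos hA.1
  refine h𝒲.act_mem ha.adj (fun j => ?_) hf
  obtain ⟨C, hC⟩ := h𝒜.coeff_bdd (mem_coeff_of_mem_alg (h𝒜.alg_pos hA) (-j))
  exact ⟨C, fun n => hC _⟩

/-! ### Dyadic operators -/

theorem dyad_add_left (f f' g : ℤ → ℂ) : dyad (f + f') g = dyad f g + dyad f' g := by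
  ext j n
  by_cases hj : j ≤ 0 <;> simp [dyad_apply, hj, add_mul]

theorem dyad_add_right (f g g' : ℤ → ℂ) : dyad f (g + g') = dyad f g + dyad f g' := by
  ext j n
  by_cases hj : j ≤ 0 <;> simp [dyad_apply, hj, mul_add]

theorem dyad_smul_left (c : ℂ) (f g : ℤ → ℂ) : dyad (c • f) g = c • dyad f g := by
  ext j n
  by_cases hj : j ≤ 0 <;> simp [dyad_apply, hj, mul_assoc]

theorem dyad_smul_right (c : ℂ) (f g : ℤ → ℂ) : dyad f (c • g) = c • dyad f g := by
  ext j n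
  by_cases hj : j ≤ 0 <;> simp [dyad_apply, hj, mul_left_comm]

theorem dyad_neg_left (f g : ℤ → ℂ) : dyad (-f) g = -dyad f g := by
  simpa using dyad_smul_left (-1) f g

theorem dyad_zero_left (g : ℤ → ℂ) : dyad 0 g = 0 := by
  simpa using dyad_smul_left 0 0 g

theorem dyad_zero_right (f : ℤ → ℂ) : dyad f 0 = 0 := by
  simpa using dyad_smul_right 0 f 0

/-! ### Linearity of `thetaOp` -/

theorem bracket_add_right {A B C : ShiftOp} (hA : ∃ a, OrdLE a A) (hB : ∃ a, OrdLE a B)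
    (hC : ∃ a, OrdLE a C) : bracket A (B + C) = bracket A B + bracket A C := by
  obtain ⟨A, rfl⟩ := BddOp.exists_val_eq hA
  obtain ⟨B, rfl⟩ := BddOp.exists_val_eq hB
  obtain ⟨C, rfl⟩ := BddOp.exists_val_eq hC
  have h : A * (B + C) - (B + C) * A = (A * B - B * A) + (A * C - C * A) := by noncomm_ring
  have h' := congrArg BddOp.val h
  rwa [BddOp.val_add, BddOp.val_bracket, BddOp.val_bracket, BddOp.val_bracket, BddOp.val_add] at h'

theorem bracket_add_left {A B C : ShiftOp} (hA : ∃ a, OrdLE a A) (hB : ∃ a, OrdLE a B)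
    (hC : ∃ a, OrdLE a C) : bracket (A + B) C = bracket A C + bracket B C := by
  have hAB : ∃ a, OrdLE a (A + B) := by
    obtain ⟨a, ha⟩ := hA
    obtain ⟨b, hb⟩ := hB
    exact ⟨max a b, (ha.mono (le_max_left _ _)).add (hb.mono (le_max_right _ _))⟩
  rw [bracket_neg_eq C, bracket_add_right hC hA hB, bracket_neg_eq C A, bracket_neg_eq C B]
  abel

theorem bracket_smul_right (c : ℂ) (A B : ShiftOp) : bracket A (c • B) = c • bracket A B := by
  rw [bracket, ShiftOp.smul_mul, ShiftOp.mul_smul, ← smul_sub, bracket]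

theorem spos_add (A B : ShiftOp) : spos (A + B) = spos A + spos B := by
  ext j n
  by_cases hj : 0 < j <;> simp [spos, hj]

theorem spos_smul (c : ℂ) (A : ShiftOp) : spos (c • A) = c • spos A := by
  ext j n
  by_cases hj : 0 < j <;> simp [spos, hj]

theorem exists_ordLE_pos {A : ShiftOp} (hA : ∃ a, OrdLE a A) : ∃ a, OrdLE a (pos A) :=
  hA.imp fun _ => ordLE_pos

theorem thetaOp_add_left {A B C : ShiftOp} (hA : ∃ a, OrdLE a A) (hB : ∃ a, OrdLE a B)
    (hC : ∃ a, OrdLE a C) : thetaOp (A + B) C = thetaOp A C + thetaOp B C := by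
  rw [thetaOp, thetaOp, thetaOp, bracket_add_left hA hB hC,
    bracket_add_left hA hB (exists_ordLE_pos hC), spos_add]
  abel

theorem thetaOp_add_right {A B C : ShiftOp} (hA : ∃ a, OrdLE a A) (hB : ∃ a, OrdLE a B)
    (hC : ∃ a, OrdLE a C) : thetaOp A (B + C) = thetaOp A B + thetaOp A C := by
  rw [thetaOp, thetaOp, thetaOp, bracket_add_right hA hB hC, pos_add,
    bracket_add_right hA (exists_ordLE_pos hB) (exists_ordLE_pos hC), spos_add]
  abel

theorem thetaOp_smul_right (c : ℂ) (A B : ShiftOp) : thetaOp A (c • B) = c • thetaOp A B := by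
  rw [thetaOp, thetaOp, bracket_smul_right, pos_smul, bracket_smul_right, spos_smul, smul_sub]

theorem thetaOp_add_sum_left {ι : Type*} (s : Finset ι) {A B : ShiftOp} {D : ι → ShiftOp}
    (hA : ∃ a, OrdLE a A) (hB : ∃ a, OrdLE a B) (hD : ∀ i, OrdLE 0 (D i)) :
    thetaOp (A + ∑ i ∈ s, D i) B = thetaOp A B + ∑ i ∈ s, thetaOp (D i) B := by
  classical
  induction s using Finset.induction_on with
  | empty => simp
  | insert i s hi ih =>
    have hs : OrdLE 0 (∑ i ∈ s, D i) :=
      Finset.sum_induction D (OrdLE 0) (fun _ _ h h' => h.add h') (fun _ _ _ => rfl)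
        fun i _ => hD i
    obtain ⟨a, ha⟩ := hA
    have hAs : ∃ a, OrdLE a (A + ∑ i ∈ s, D i) :=
      ⟨max a 0, (ha.mono (le_max_left _ _)).add (hs.mono (le_max_right _ _))⟩
    rw [Finset.sum_insert hi, Finset.sum_insert hi, add_left_comm,
      thetaOp_add_left ⟨0, hD i⟩ hAs hB, ih]
    abel

/-- Here nothing is cut off, so `[l, r_+] - [l, r]` collapses to `-[l, r_-]`. -/
theorem thetaOp_apply_of_pos {l r : ShiftOp} (hl : ∃ a, OrdLE a l) (hr : ∃ a, OrdLE a r) {j : ℤ}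
    (hj : 0 < j) (n : ℤ) : thetaOp l r j n = -bracket l (neg r) j n := by
  have h := bracket_add_right hl (exists_ordLE_pos hr) ⟨-1, ordLE_neg r⟩
  rw [pos_add_neg] at h
  rw [thetaOp, ShiftOp.sub_apply, spos, if_pos hj, h, ShiftOp.add_apply]
  ring

theorem thetaOp_apply_of_nonpos (l r : ShiftOp) {j : ℤ} (hj : j ≤ 0) (n : ℤ) :
    thetaOp l r j n = bracket l (pos r) j n := by
  rw [thetaOp, ShiftOp.sub_apply, spos, if_neg hj.not_gt, sub_zero]

/-- In orders `k ≤ 0` the commutator of the dyad with `r_+` is computed exactly by letting `r_+` act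
on `f` and `r_+^*` on `g`. In positive orders only `-[D, r_-]` could occur, and its order is
negative. This carries the conjugation `Θ = B' Θ̃ B'^*`. -/
theorem thetaOp_dyad (f g : ℤ → ℂ) {r : ShiftOp} (hr : ∃ a, OrdLE a r) :
    thetaOp (dyad f g) r = dyad f (act (adj (pos r)) g) - dyad (act (pos r) f) g := by
  ext k n
  rcases le_or_gt k 0 with hk | hk
  · rw [thetaOp_apply_of_nonpos _ _ hk, bracket, ShiftOp.sub_apply, ShiftOp.sub_apply,
      dyad_apply, dyad_apply, if_pos hk, if_pos hk]
    congr 1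
    · rw [act, ShiftOp.mul_apply, mul_finsum]
      -- The substitution `j ↦ j - k` produces the adjoint. The condition `j ≤ k` coming from `r_+`
      -- already implies the condition `j ≤ 0` of the dyad, because `k ≤ 0`.
      refine Eq.trans (finsum_congr fun j => ?_) (finsum_comp_equiv (Equiv.subRight k))
      have h : n + k + (j - k) = n + j := by ring
      simp only [Equiv.subRight_apply, dyad_apply, adj, pos_apply, neg_sub, sub_nonneg, h]
      by_cases hj : j ≤ k
      · simp only [hj, hj.trans hk, if_true]
        ring
      · simp [hj]
    · rw [act, ShiftOp.mul_apply, finsum_mul]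
      refine finsum_congr fun j => ?_
      have h : n + j + (k - j) = n + k := by ring
      simp only [dyad_apply, pos_apply, h]
      by_cases hj : 0 ≤ j
      · simp only [hj, if_true, show k - j ≤ 0 by omega]
        ring
      · simp [hj]
  · rw [thetaOp_apply_of_pos ⟨0, dyad_ordLE f g⟩ hr hk,
      (dyad_ordLE f g).bracket (ordLE_neg r) k (by omega), ShiftOp.sub_apply,
      dyad_ordLE _ _ k hk, dyad_ordLE _ _ k hk]
    simp

/-! ### Pairings on the extended phase space -/

/-- A coefficient space `𝒜` together with a sequence space `𝒲` whose products lie in `𝒜`. -/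
structure IsExtSpace (𝒜 𝒲 : Set (ℤ → ℂ)) : Prop where
  coeff : IsCoeffSpace 𝒜
  seq : IsSeqSpace 𝒲
  mul_mem : ∀ f ∈ 𝒲, ∀ g ∈ 𝒲, (fun n => f n * g n) ∈ 𝒜

theorem isExtSpace_Schwartz : IsExtSpace Schwartz Schwartz :=
  ⟨isCoeffSpace_Schwartz, isSeqSpace_Schwartz, fun _ hf _ hg => mul_mem_Schwartz hf hg⟩

theorem isExtSpace_L1_L2 : IsExtSpace L1 L2 :=
  ⟨isCoeffSpace_L1, isSeqSpace_L2, fun _ hf _ hg => mul_mem_L1 hf hg⟩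

theorem seqPair_comm (f g : ℤ → ℂ) : seqPair f g = seqPair g f :=
  tsum_congr fun _ => mul_comm _ _

theorem seqPair_smul_left (c : ℂ) (f g : ℤ → ℂ) : seqPair (c • f) g = c * seqPair f g := by
  simp only [seqPair, Pi.smul_apply, smul_eq_mul, mul_assoc, tsum_mul_left]

theorem seqPair_smul_right (c : ℂ) (f g : ℤ → ℂ) : seqPair f (c • g) = c * seqPair f g := by
  rw [seqPair_comm, seqPair_smul_left, seqPair_comm]

theorem seqPair_neg_left (f g : ℤ → ℂ) : seqPair (-f) g = -seqPair f g := by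
  simpa using seqPair_smul_left (-1) f g

theorem seqPair_neg_right (f g : ℤ → ℂ) : seqPair f (-g) = -seqPair f g := by
  simpa using seqPair_smul_right (-1) f g

theorem seqPair_single_right (f : ℤ → ℂ) (m : ℤ) : seqPair f (Pi.single m 1) = f m := by
  rw [seqPair, tsum_eq_single m fun n hn => by rw [Pi.single_eq_of_ne hn, mul_zero]]
  simp

section Phase

variable {N : ℕ} {z w : Ext N} {𝒜 𝒲 : Set (ℤ → ℂ)}

theorem phase_add (h𝒜 : IsCoeffSpace 𝒜) (h𝒲 : IsSeqSpace 𝒲) (hz : z ∈ Phase 𝒜 𝒲 N)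
    (hw : w ∈ Phase 𝒜 𝒲 N) : z + w ∈ Phase 𝒜 𝒲 N :=
  ⟨h𝒜.alg_add hz.1 hw.1, fun i => h𝒲.add _ (hz.2.1 i) _ (hw.2.1 i),
    fun i => h𝒲.add _ (hz.2.2 i) _ (hw.2.2 i)⟩

theorem phase_smul (h𝒜 : IsCoeffSpace 𝒜) (h𝒲 : IsSeqSpace 𝒲) (c : ℂ) (hz : z ∈ Phase 𝒜 𝒲 N) :
    c • z ∈ Phase 𝒜 𝒲 N :=
  ⟨h𝒜.alg_smul c hz.1, fun i => h𝒲.smul c (hz.2.1 i), fun i => h𝒲.smul c (hz.2.2 i)⟩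

/-- The field contains no dyadic term, so the products `𝒲 · 𝒲 ⊆ 𝒜` are not needed; this permits
`𝒮(ℤ)` together with `ℓ²`. -/
theorem coupledField_mem (h𝒜 : IsCoeffSpace 𝒜) (h𝒲 : IsSeqSpace 𝒲) (hz : z ∈ Phase 𝒜 𝒲 N)
    {g : ShiftOp} (hg : g ∈ Alg 𝒜) : coupledField g z ∈ Phase 𝒜 𝒲 N :=
  ⟨h𝒜.alg_bracket (h𝒜.alg_pos hg) hz.1, fun i => h𝒜.act_pos_mem h𝒲 hg (hz.2.1 i),
    fun i => h𝒲.neg (h𝒜.act_adj_pos_mem h𝒲 hg (hz.2.2 i))⟩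

end Phase

theorem pair_smul_left {N : ℕ} (c : ℂ) (ξ v : Ext N) : pair (c • ξ) v = c * pair ξ v := by
  simp only [pair, Prod.smul_fst, Prod.smul_snd, Pi.smul_apply, form_smul_left,
    seqPair_smul_left, mul_add, Finset.mul_sum]

theorem pair_smul_right {N : ℕ} (c : ℂ) (ξ v : Ext N) : pair ξ (c • v) = c * pair ξ v := by
  simp only [pair, Prod.smul_fst, Prod.smul_snd, Pi.smul_apply, form_smul_right,
    seqPair_smul_right, mul_add, Finset.mul_sum]

namespace IsExtSpace

variable {𝒜 𝒲 : Set (ℤ → ℂ)} (H : IsExtSpace 𝒜 𝒲)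
include H

theorem summable_mul {f g : ℤ → ℂ} (hf : f ∈ 𝒲) (hg : g ∈ 𝒲) : Summable fun n => f n * g n :=
  (H.coeff.summable _ (H.mul_mem f hf g hg)).of_norm

theorem seqPair_add_left {f f' g : ℤ → ℂ} (hf : f ∈ 𝒲) (hf' : f' ∈ 𝒲) (hg : g ∈ 𝒲) :
    seqPair (f + f') g = seqPair f g + seqPair f' g := by
  rw [seqPair, seqPair, seqPair, ← (H.summable_mul hf hg).tsum_add (H.summable_mul hf' hg)]
  simp [add_mul]

theorem seqPair_add_right {f g g' : ℤ → ℂ} (hf : f ∈ 𝒲) (hg : g ∈ 𝒲) (hg' : g' ∈ 𝒲) :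
    seqPair f (g + g') = seqPair f g + seqPair f g' := by
  rw [seqPair_comm, H.seqPair_add_left hg hg' hf, seqPair_comm g, seqPair_comm g']

theorem seqPair_sub_left {f f' g : ℤ → ℂ} (hf : f ∈ 𝒲) (hf' : f' ∈ 𝒲) (hg : g ∈ 𝒲) :
    seqPair (f - f') g = seqPair f g - seqPair f' g := by
  rw [sub_eq_add_neg, H.seqPair_add_left hf (H.seq.neg hf') hg, seqPair_neg_left, sub_eq_add_neg]

theorem seqPair_sub_right {f g g' : ℤ → ℂ} (hf : f ∈ 𝒲) (hg : g ∈ 𝒲) (hg' : g' ∈ 𝒲) :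
    seqPair f (g - g') = seqPair f g - seqPair f g' := by
  rw [seqPair_comm, H.seqPair_sub_left hg hg' hf, seqPair_comm g, seqPair_comm g']

/-- Only finitely many orders occur and each series converges absolutely, so each order can be
translated separately. -/
theorem seqPair_act_pos {r : ShiftOp} (hr : r ∈ Alg 𝒜) {f g : ℤ → ℂ} (hf : f ∈ 𝒲) (hg : g ∈ 𝒲) :
    seqPair (act (adj (pos r)) g) f = seqPair g (act (pos r) f) := by
  obtain ⟨m, hm⟩ := exists_finOrd_pos hr.1
  have hb := fun j => H.coeff.coeff_bdd (mem_coeff_of_mem_alg (H.coeff.alg_pos hr) j)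
  have hs : ∀ j, Summable fun n => g n * (pos r j n * f (n + j)) := fun j =>
    H.summable_mul hg (H.seq.bdd_mul _ (hb j) _ (H.seq.shift f hf j))
  have hs' : ∀ j, Summable fun n => adj (pos r) j n * g (n + j) * f n := fun j => by
    obtain ⟨C, hC⟩ := hb (-j)
    exact H.summable_mul
      (H.seq.bdd_mul (adj (pos r) j) ⟨C, fun n => hC _⟩ _ (H.seq.shift g hg j)) hf
  have h1 : seqPair g (act (pos r) f)
      = ∑ j ∈ Finset.Icc (-m) m, ∑' n, g n * (pos r j n * f (n + j)) := by
    rw [← Summable.tsum_finsetSum fun j _ => hs j, seqPair]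
    simp only [hm.act_apply, Finset.mul_sum]
  have h2 : seqPair (act (adj (pos r)) g) f
      = ∑ j ∈ Finset.Icc (-m) m, ∑' n, adj (pos r) j n * g (n + j) * f n := by
    rw [← Summable.tsum_finsetSum fun j _ => hs' j, seqPair]
    simp only [hm.adj.act_apply, Finset.sum_mul]
  rw [h1, h2]
  refine Finset.sum_nbij' (-·) (-·) ?_ ?_ ?_ ?_ ?_
  · intro j hj
    have := Finset.mem_Icc.mp hj
    exact Finset.mem_Icc.mpr ⟨by omega, by omega⟩
  · intro j hj
    have := Finset.mem_Icc.mp hj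
    exact Finset.mem_Icc.mpr ⟨by omega, by omega⟩
  · intro j _; exact neg_neg j
  · intro j _; exact neg_neg j
  · intro j _
    rw [← (Equiv.addRight j).tsum_eq fun n => g n * (pos r (-j) n * f (n + -j))]
    refine tsum_congr fun n => ?_
    simp only [Equiv.coe_addRight, adj, add_neg_cancel_right]
    ring

theorem alg_dyad {f g : ℤ → ℂ} (hf : f ∈ 𝒲) (hg : g ∈ 𝒲) : dyad f g ∈ Alg 𝒜 := by
  refine ⟨⟨0, dyad_ordLE f g⟩, fun j hj => ?_, fun j hj => ⟨0, ?_⟩⟩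
  · rw [show dyad f g j = fun n => f n * g (n + j) from funext fun n => by
      rw [dyad_apply, if_pos hj]]
    exact H.mul_mem f hf _ (H.seq.shift g hg j)
  · simp only [dyad_ordLE f g j hj, sub_zero]
    exact H.coeff.zero

/-- A dyad has only orders `≤ 0` and therefore sees only `r_+`; its coefficients `f(n) g(n + k)`
turn the trace into a pairing of sequences. -/
theorem form_dyad {r : ShiftOp} (hr : r ∈ Alg 𝒜) {f g : ℤ → ℂ} (hf : f ∈ 𝒲) (hg : g ∈ 𝒲) :
    form r (dyad f g) = seqPair g (act (pos r) f) := by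
  obtain ⟨m, hm⟩ := exists_finOrd_pos hr.1
  obtain ⟨a, ha⟩ := hr.1
  have hb := fun j => H.coeff.coeff_bdd (mem_coeff_of_mem_alg (H.coeff.alg_pos hr) j)
  have hs : ∀ j, Summable fun n => g n * (pos r j n * f (n + j)) := fun j =>
    H.summable_mul hg (H.seq.bdd_mul _ (hb j) _ (H.seq.shift f hf j))
  have h1 : seqPair g (act (pos r) f)
      = ∑ j ∈ Finset.Icc (-m) m, ∑' n, g n * (pos r j n * f (n + j)) := by
    rw [← Summable.tsum_finsetSum fun j _ => hs j, seqPair]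
    simp only [hm.act_apply, Finset.mul_sum]
  have h2 : form r (dyad f g) = form (pos r) (dyad f g) := by
    refine tsum_congr fun n => finsum_congr fun j => ?_
    by_cases hj : 0 ≤ j <;> simp [pos_apply, dyad_apply, hj]
  -- The bound `m` may be negative, in which case both ranges are empty.
  have hI : Finset.Icc (-0) m ⊆ Finset.Icc (-m) m ∨ m < 0 := by
    rcases le_or_gt 0 m with h | h
    · exact Or.inl (Finset.Icc_subset_Icc (by omega) le_rfl)
    · exact Or.inr h
  rw [h1, h2, H.coeff.form_eq (H.coeff.alg_pos hr) (H.alg_dyad hf hg) hm.ordLE (dyad_ordLE f g)]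
  rcases hI with hI | hI
  · rw [← Finset.sum_subset hI]
    · refine Finset.sum_congr rfl fun j hj => tsum_congr fun n => ?_
      have hj' := (Finset.mem_Icc.mp hj).1
      rw [dyad_apply, if_pos (by omega), add_neg_cancel_right]
      ring
    · intro j hj hj'
      rw [Finset.mem_Icc] at hj hj'
      simp [pos_apply, show ¬ 0 ≤ j by omega]
  · rw [Finset.Icc_eq_empty (by omega), Finset.Icc_eq_empty (by omega)]
    simp

variable {N : ℕ}

theorem pair_add_left {ξ η v : Ext N} (hξ : ξ ∈ Phase 𝒜 𝒲 N) (hη : η ∈ Phase 𝒜 𝒲 N)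
    (hv : v ∈ Phase 𝒜 𝒲 N) : pair (ξ + η) v = pair ξ v + pair η v := by
  simp only [pair, Prod.fst_add, Prod.snd_add, Pi.add_apply,
    H.coeff.form_add_left hξ.1 hη.1 hv.1]
  rw [Finset.sum_congr rfl fun i _ => H.seqPair_add_left (hξ.2.1 i) (hη.2.1 i) (hv.2.1 i),
    Finset.sum_congr rfl fun i _ => H.seqPair_add_left (hξ.2.2 i) (hη.2.2 i) (hv.2.2 i),
    Finset.sum_add_distrib, Finset.sum_add_distrib]
  ring

theorem pair_add_right {ξ v w : Ext N} (hξ : ξ ∈ Phase 𝒜 𝒲 N) (hv : v ∈ Phase 𝒜 𝒲 N)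
    (hw : w ∈ Phase 𝒜 𝒲 N) : pair ξ (v + w) = pair ξ v + pair ξ w := by
  simp only [pair, Prod.fst_add, Prod.snd_add, Pi.add_apply,
    H.coeff.form_add_right hξ.1 hv.1 hw.1]
  rw [Finset.sum_congr rfl fun i _ => H.seqPair_add_right (hξ.2.1 i) (hv.2.1 i) (hw.2.1 i),
    Finset.sum_congr rfl fun i _ => H.seqPair_add_right (hξ.2.2 i) (hv.2.2 i) (hw.2.2 i),
    Finset.sum_add_distrib, Finset.sum_add_distrib]
  ring

theorem phase_add {z w : Ext N} (hz : z ∈ Phase 𝒜 𝒲 N) (hw : w ∈ Phase 𝒜 𝒲 N) :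
    z + w ∈ Phase 𝒜 𝒲 N := ShiftLax.phase_add H.coeff H.seq hz hw

theorem phase_smul {z : Ext N} (c : ℂ) (hz : z ∈ Phase 𝒜 𝒲 N) :
    c • z ∈ Phase 𝒜 𝒲 N := ShiftLax.phase_smul H.coeff H.seq c hz

/-- Operators `Θ` with `(ξ, Θ_z η) = ([ξ, η], z) + ω(ξ, η)` for a Lie bracket on covectors and a
2-cocycle `ω` are Poisson structures. -/
theorem isImplectic_of_lieBracket {Θ cb : Ext N → Ext N → Ext N} {ω : Ext N → Ext N → ℂ}
    (mem : ∀ z ∈ Phase 𝒜 𝒲 N, ∀ α ∈ Phase 𝒜 𝒲 N, Θ z α ∈ Phase 𝒜 𝒲 N)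
    (linear : ∀ z ∈ Phase 𝒜 𝒲 N, ∀ α ∈ Phase 𝒜 𝒲 N, ∀ β ∈ Phase 𝒜 𝒲 N, ∀ c : ℂ,
      Θ z (c • α + β) = c • Θ z α + Θ z β)
    (cb_mem : ∀ α ∈ Phase 𝒜 𝒲 N, ∀ β ∈ Phase 𝒜 𝒲 N, cb α β ∈ Phase 𝒜 𝒲 N)
    (pair_eq : ∀ z ∈ Phase 𝒜 𝒲 N, ∀ α ∈ Phase 𝒜 𝒲 N, ∀ β ∈ Phase 𝒜 𝒲 N,
      pair α (Θ z β) = pair (cb α β) z + ω α β)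
    (cb_swap : ∀ α ∈ Phase 𝒜 𝒲 N, ∀ β ∈ Phase 𝒜 𝒲 N, cb α β = (-1 : ℂ) • cb β α)
    (ω_swap : ∀ α ∈ Phase 𝒜 𝒲 N, ∀ β ∈ Phase 𝒜 𝒲 N, ω α β = -ω β α)
    (cb_jacobi : ∀ α ∈ Phase 𝒜 𝒲 N, ∀ β ∈ Phase 𝒜 𝒲 N, ∀ γ ∈ Phase 𝒜 𝒲 N,
      cb (cb β γ) α + cb (cb γ α) β + cb (cb α β) γ = 0)
    (ω_cocycle : ∀ α ∈ Phase 𝒜 𝒲 N, ∀ β ∈ Phase 𝒜 𝒲 N, ∀ γ ∈ Phase 𝒜 𝒲 N,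
      ω (cb β γ) α + ω (cb γ α) β + ω (cb α β) γ = 0) :
    IsImplectic 𝒜 𝒲 Θ := by
  have hd : ∀ z ∈ Phase 𝒜 𝒲 N, ∀ v ∈ Phase 𝒜 𝒲 N, ∀ α ∈ Phase 𝒜 𝒲 N, ∀ β ∈ Phase 𝒜 𝒲 N,
      HasDerivAt (fun t : ℂ => pair α (Θ (z + t • v) β)) (pair (cb α β) v) 0 := by
    intro z hz v hv α hα β hβ
    -- The pairing is affine in the base point, hence affine in `t`, with slope `pair (cb α β) v`.
    have h : (fun t : ℂ => pair α (Θ (z + t • v) β))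
        = fun t : ℂ => t * pair (cb α β) v + (pair (cb α β) z + ω α β) := by
      ext t
      rw [pair_eq _ (H.phase_add hz (H.phase_smul t hv)) α hα β hβ,
        H.pair_add_right (cb_mem α hα β hβ) hz (H.phase_smul t hv), pair_smul_right]
      ring
    rw [h]
    simpa using ((hasDerivAt_id (0 : ℂ)).mul_const (pair (cb α β) v)).add_const
      (pair (cb α β) z + ω α β)
  refine ⟨mem, linear, fun z hz α hα β hβ => ?_, fun z hz v hv α hα β hβ =>
    (hd z hz v hv α hα β hβ).differentiableAt, fun z hz α hα β hβ γ hγ => ?_⟩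
  · rw [pair_eq z hz α hα β hβ, pair_eq z hz β hβ α hα, cb_swap α hα β hβ, ω_swap α hα β hβ,
      pair_smul_left]
    ring
  · have hαβ := cb_mem α hα β hβ
    have hβγ := cb_mem β hβ γ hγ
    have hγα := cb_mem γ hγ α hα
    -- Each derivative is `([β, γ], Θ_z α) = ([[β, γ], α], z) + ω([β, γ], α)`; the cyclic sum
    -- vanishes by the Jacobi identity of `cb` paired with `z` and by the cocycle identity.
    rw [(hd z hz _ (mem z hz α hα) β hβ γ hγ).deriv, (hd z hz _ (mem z hz β hβ) γ hγ α hα).deriv,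
      (hd z hz _ (mem z hz γ hγ) α hα β hβ).deriv, pair_eq z hz _ hβγ α hα,
      pair_eq z hz _ hγα β hβ, pair_eq z hz _ hαβ γ hγ]
    have h := congrArg (fun ξ => pair ξ z) (cb_jacobi α hα β hβ γ hγ)
    have h1 := cb_mem _ hβγ α hα
    have h2 := cb_mem _ hγα β hβ
    have h3 := cb_mem _ hαβ γ hγ
    have h0 : pair (0 : Ext N) z = 0 := by simpa using pair_smul_left 0 (0 : Ext N) z
    simp only [H.pair_add_left (H.phase_add h1 h2) h3 hz, H.pair_add_left h1 h2 hz, h0] at h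
    linear_combination h + ω_cocycle α hα β hβ γ hγ

end IsExtSpace

/-! ### The Poisson structures `Θ̃` and `Θ` -/

/-- The canonical 2-cocycle on covectors. -/
def canonicalForm {N : ℕ} (ξ η : Ext N) : ℂ :=
  ∑ i, (seqPair (ξ.2.2 i) (η.2.1 i) - seqPair (ξ.2.1 i) (η.2.2 i))

/-- The Lie bracket on covectors of the linear part of `thetaTilde`. -/
def opBracket {N : ℕ} (ξ η : Ext N) : Ext N := (rBracket η.1 ξ.1, 0, 0)

/-- The Lie bracket on covectors of the linear part of `theta`. -/
def semidirectBracket {N : ℕ} (ξ η : Ext N) : Ext N :=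
  (rBracket η.1 ξ.1,
    fun i => act (adj (pos ξ.1)) (η.2.1 i) - act (adj (pos η.1)) (ξ.2.1 i),
    fun i => act (pos η.1) (ξ.2.2 i) - act (pos ξ.1) (η.2.2 i))

theorem canonicalForm_swap {N : ℕ} (ξ η : Ext N) : canonicalForm ξ η = -canonicalForm η ξ := by
  rw [canonicalForm, canonicalForm, ← Finset.sum_neg_distrib]
  refine Finset.sum_congr rfl fun i _ => ?_
  rw [seqPair_comm (ξ.2.1 i), seqPair_comm (ξ.2.2 i)]
  ring

namespace IsExtSpace

variable {𝒜 𝒲 : Set (ℤ → ℂ)} (H : IsExtSpace 𝒜 𝒲) {N : ℕ}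
include H

theorem act_pos_mem {r : ShiftOp} (hr : r ∈ Alg 𝒜) {f : ℤ → ℂ} (hf : f ∈ 𝒲) :
    act (pos r) f ∈ 𝒲 := H.coeff.act_pos_mem H.seq hr hf

theorem act_adj_pos_mem {r : ShiftOp} (hr : r ∈ Alg 𝒜) {f : ℤ → ℂ} (hf : f ∈ 𝒲) :
    act (adj (pos r)) f ∈ 𝒲 := H.coeff.act_adj_pos_mem H.seq hr hf

theorem thetaTilde_mem {z ξ : Ext N} (hz : z ∈ Phase 𝒜 𝒲 N) (hξ : ξ ∈ Phase 𝒜 𝒲 N) :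
    thetaTilde z ξ ∈ Phase 𝒜 𝒲 N :=
  ⟨H.coeff.alg_thetaOp hz.1 hξ.1, fun i => H.seq.neg (hξ.2.2 i), hξ.2.1⟩

theorem isImplectic_thetaTilde : IsImplectic 𝒜 𝒲 (thetaTilde (N := N)) := by
  refine H.isImplectic_of_lieBracket (cb := opBracket) (ω := canonicalForm)
    (fun z hz α hα => H.thetaTilde_mem hz hα) ?_ ?_ ?_ ?_ (fun α _ β _ => canonicalForm_swap α β)
    ?_ ?_
  · intro z hz α hα β hβ c
    refine Prod.ext ?_ (Prod.ext ?_ rfl)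
    · exact (thetaOp_add_right hz.1.1 (H.coeff.alg_smul c hα.1).1 hβ.1.1).trans
        (by rw [thetaOp_smul_right]; rfl)
    · ext i n
      simp [thetaTilde]
      ring
  · exact fun α hα β hβ => ⟨H.coeff.alg_rBracket hβ.1 hα.1, fun _ => H.seq.zero,
      fun _ => H.seq.zero⟩
  · intro z hz α hα β hβ
    have h0 : ∀ f, seqPair 0 f = 0 := fun f => by simpa using seqPair_smul_left 0 0 f
    simp only [pair, thetaTilde, opBracket, Pi.neg_apply, Pi.zero_apply, h0,
      H.coeff.form_thetaOp hz.1 hα.1 hβ.1, seqPair_neg_right, canonicalForm,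
      Finset.sum_neg_distrib, Finset.sum_sub_distrib, Finset.sum_const_zero]
    ring
  · intro α _ β _
    simp [opBracket, rBracket_swap β.1 α.1]
  · intro α hα β hβ γ hγ
    refine Prod.ext ?_ (Prod.ext (by simp [opBracket]) (by simp [opBracket]))
    exact rBracket_jacobi_right hα.1.1 hβ.1.1 hγ.1.1
  · intro α _ β _ γ _
    have h0 : ∀ f, seqPair 0 f = 0 := fun f => by simpa using seqPair_smul_left 0 0 f
    simp [canonicalForm, opBracket, h0]

theorem alg_sum_dyad {f g : Fin N → ℤ → ℂ} (hf : ∀ i, f i ∈ 𝒲) (hg : ∀ i, g i ∈ 𝒲) :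
    ∑ i, dyad (f i) (g i) ∈ Alg 𝒜 :=
  H.coeff.alg_sum _ fun i _ => H.alg_dyad (hf i) (hg i)

theorem theta_mem {z ξ : Ext N} (hz : z ∈ Phase 𝒜 𝒲 N) (hξ : ξ ∈ Phase 𝒜 𝒲 N) :
    theta z ξ ∈ Phase 𝒜 𝒲 N :=
  ⟨H.coeff.alg_add (H.coeff.alg_thetaOp hz.1 hξ.1) (H.coeff.alg_sum _ fun i _ =>
      H.coeff.alg_sub (H.alg_dyad (hz.2.1 i) (hξ.2.1 i)) (H.alg_dyad (hξ.2.2 i) (hz.2.2 i))),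
    fun i => H.seq.sub (H.seq.neg (hξ.2.2 i)) (H.act_pos_mem hξ.1 (hz.2.1 i)),
    fun i => H.seq.add _ (hξ.2.1 i) _ (H.act_adj_pos_mem hξ.1 (hz.2.2 i))⟩

theorem semidirectBracket_mem {ξ η : Ext N} (hξ : ξ ∈ Phase 𝒜 𝒲 N) (hη : η ∈ Phase 𝒜 𝒲 N) :
    semidirectBracket ξ η ∈ Phase 𝒜 𝒲 N :=
  ⟨H.coeff.alg_rBracket hη.1 hξ.1,
    fun i => H.seq.sub (H.act_adj_pos_mem hξ.1 (hη.2.1 i)) (H.act_adj_pos_mem hη.1 (hξ.2.1 i)),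
    fun i => H.seq.sub (H.act_pos_mem hη.1 (hξ.2.2 i)) (H.act_pos_mem hξ.1 (hη.2.2 i))⟩

/-- All operators are moved onto the covectors, by `form_thetaOp`, `form_dyad` and
`seqPair_act_pos`. Terms containing `z` give the bracket; those without `z` give the canonical form.
-/
theorem pair_theta {z ξ η : Ext N} (hz : z ∈ Phase 𝒜 𝒲 N) (hξ : ξ ∈ Phase 𝒜 𝒲 N)
    (hη : η ∈ Phase 𝒜 𝒲 N) :
    pair ξ (theta z η) = pair (semidirectBracket ξ η) z + canonicalForm ξ η := by
  have h1 : form ξ.1 (theta z η).1 = form (rBracket η.1 ξ.1) z.1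
      + ∑ i, (seqPair (η.2.1 i) (act (pos ξ.1) (z.2.1 i))
        - seqPair (z.2.2 i) (act (pos ξ.1) (η.2.2 i))) := by
    have h := H.coeff.form_add_sum Finset.univ hξ.1 (H.coeff.alg_thetaOp hz.1 hη.1)
      (D := fun i => dyad (z.2.1 i) (η.2.1 i) - dyad (η.2.2 i) (z.2.2 i)) fun i =>
        H.coeff.alg_sub (H.alg_dyad (hz.2.1 i) (hη.2.1 i)) (H.alg_dyad (hη.2.2 i) (hz.2.2 i))
    refine h.trans ?_
    rw [H.coeff.form_thetaOp hz.1 hξ.1 hη.1]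
    congr 1
    refine Finset.sum_congr rfl fun i _ => ?_
    rw [H.coeff.form_sub_right hξ.1 (H.alg_dyad (hz.2.1 i) (hη.2.1 i))
      (H.alg_dyad (hη.2.2 i) (hz.2.2 i)), H.form_dyad hξ.1 (hz.2.1 i) (hη.2.1 i),
      H.form_dyad hξ.1 (hη.2.2 i) (hz.2.2 i)]
  rw [pair, pair, h1, canonicalForm, add_assoc, add_assoc, add_assoc, add_assoc]
  congr 1
  rw [← Finset.sum_add_distrib, ← Finset.sum_add_distrib, ← Finset.sum_add_distrib,
    ← Finset.sum_add_distrib]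
  refine Finset.sum_congr rfl fun i _ => ?_
  have hf := hz.2.1 i
  have hg := hz.2.2 i
  simp only [theta, semidirectBracket]
  rw [H.seqPair_sub_right (hξ.2.1 i) (H.seq.neg (hη.2.2 i)) (H.act_pos_mem hη.1 hf),
    H.seqPair_add_right (hξ.2.2 i) (hη.2.1 i) (H.act_adj_pos_mem hη.1 hg),
    H.seqPair_sub_left (H.act_adj_pos_mem hξ.1 (hη.2.1 i)) (H.act_adj_pos_mem hη.1 (hξ.2.1 i)) hf,
    H.seqPair_sub_left (H.act_pos_mem hη.1 (hξ.2.2 i)) (H.act_pos_mem hξ.1 (hη.2.2 i)) hg,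
    seqPair_neg_right, H.seqPair_act_pos hξ.1 hf (hη.2.1 i), H.seqPair_act_pos hη.1 hf (hξ.2.1 i),
    seqPair_comm (ξ.2.2 i) (act _ (z.2.2 i)), H.seqPair_act_pos hη.1 (hξ.2.2 i) hg,
    seqPair_comm (z.2.2 i), seqPair_comm (z.2.2 i)]
  ring

theorem theta_linear {z α β : Ext N} (hz : z ∈ Phase 𝒜 𝒲 N) (hα : α ∈ Phase 𝒜 𝒲 N)
    (hβ : β ∈ Phase 𝒜 𝒲 N) (c : ℂ) : theta z (c • α + β) = c • theta z α + theta z β := by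
  obtain ⟨a, ha⟩ := exists_finOrd_pos hα.1.1
  obtain ⟨b, hb⟩ := exists_finOrd_pos hβ.1.1
  have hp : ∀ f, act (pos (c • α.1 + β.1)) f = c • act (pos α.1) f + act (pos β.1) f := fun f => by
    rw [pos_add, pos_smul, (ha.smul c).act_add_op hb, act_smul_op]
  have hq : ∀ f, act (adj (pos (c • α.1 + β.1))) f
      = c • act (adj (pos α.1)) f + act (adj (pos β.1)) f := fun f => by
    rw [pos_add, pos_smul, adj_add, adj_smul, (ha.adj.smul c).act_add_op hb.adj, act_smul_op]
  refine Prod.ext ?_ (Prod.ext ?_ ?_)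
  · have ht : thetaOp z.1 (c • α.1 + β.1) = c • thetaOp z.1 α.1 + thetaOp z.1 β.1 := by
      rw [thetaOp_add_right hz.1.1 (H.coeff.alg_smul c hα.1).1 hβ.1.1, thetaOp_smul_right]
    have hs : ∑ i, (dyad (z.2.1 i) (c • α.2.1 i + β.2.1 i) - dyad (c • α.2.2 i + β.2.2 i) (z.2.2 i))
        = c • ∑ i, (dyad (z.2.1 i) (α.2.1 i) - dyad (α.2.2 i) (z.2.2 i))
          + ∑ i, (dyad (z.2.1 i) (β.2.1 i) - dyad (β.2.2 i) (z.2.2 i)) := by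
      rw [Finset.smul_sum, ← Finset.sum_add_distrib]
      refine Finset.sum_congr rfl fun i _ => ?_
      rw [dyad_add_left, dyad_add_right, dyad_smul_left, dyad_smul_right, smul_sub]
      abel
    refine (congrArg₂ (· + ·) ht hs).trans ?_
    change _ = c • (thetaOp z.1 α.1 + ∑ i, (dyad (z.2.1 i) (α.2.1 i) - dyad (α.2.2 i) (z.2.2 i)))
      + (thetaOp z.1 β.1 + ∑ i, (dyad (z.2.1 i) (β.2.1 i) - dyad (β.2.2 i) (z.2.2 i)))
    rw [smul_add]
    abel
  · ext i n
    simp only [theta, Prod.fst_add, Prod.snd_add, Prod.smul_fst, Prod.smul_snd, Pi.add_apply,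
      Pi.smul_apply, Pi.sub_apply, Pi.neg_apply, smul_eq_mul, hp]
    ring
  · ext i n
    simp only [theta, Prod.fst_add, Prod.snd_add, Prod.smul_fst, Prod.smul_snd, Pi.add_apply,
      Pi.smul_apply, smul_eq_mul, hq]
    ring

theorem isImplectic_theta : IsImplectic 𝒜 𝒲 (theta (N := N)) := by
  refine H.isImplectic_of_lieBracket (cb := semidirectBracket) (ω := canonicalForm)
    (fun z hz α hα => H.theta_mem hz hα) (fun z hz α hα β hβ c => H.theta_linear hz hα hβ c)
    (fun α hα β hβ => H.semidirectBracket_mem hα hβ)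
    (fun z hz α hα β hβ => H.pair_theta hz hα hβ) ?_ (fun α _ β _ => canonicalForm_swap α β) ?_ ?_
  · intro α _ β _
    simp only [semidirectBracket, rBracket_swap β.1 α.1]
    refine Prod.ext (by simp) (Prod.ext ?_ ?_)
    · ext i n; simp
    · ext i n; simp
  · intro α hα β hβ γ hγ
    obtain ⟨a, ha⟩ := exists_finOrd_pos hα.1.1
    obtain ⟨b, hb⟩ := exists_finOrd_pos hβ.1.1
    obtain ⟨c, hc⟩ := exists_finOrd_pos hγ.1.1
    refine Prod.ext ?_ (Prod.ext ?_ ?_)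
    · exact rBracket_jacobi_right hα.1.1 hβ.1.1 hγ.1.1
    · funext i
      simp only [semidirectBracket, Prod.snd_add, Prod.fst_add, Pi.add_apply,
        act_adj_pos_rBracket hβ.1.1 hα.1.1, act_adj_pos_rBracket hγ.1.1 hβ.1.1,
        act_adj_pos_rBracket hα.1.1 hγ.1.1, ha.adj.act_sub, hb.adj.act_sub, hc.adj.act_sub]
      change _ = (0 : ℤ → ℂ)
      abel
    · funext i
      simp only [semidirectBracket, Prod.snd_add, Pi.add_apply,
        act_pos_rBracket hβ.1.1 hα.1.1, act_pos_rBracket hγ.1.1 hβ.1.1,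
        act_pos_rBracket hα.1.1 hγ.1.1, ha.act_sub, hb.act_sub, hc.act_sub]
      change _ = (0 : ℤ → ℂ)
      abel
  · intro α hα β hβ γ hγ
    rw [canonicalForm, canonicalForm, canonicalForm, ← Finset.sum_add_distrib,
      ← Finset.sum_add_distrib]
    refine Finset.sum_eq_zero fun i _ => ?_
    -- Invariance of the canonical form: once every term reads `⟨χ, r_+ ρ⟩`, the cyclic sum has
    -- twelve terms, each of the six assignments of the three covectors occurring twice with
    -- opposite signs.
    have key : ∀ ξ ∈ Phase 𝒜 𝒲 N, ∀ η ∈ Phase 𝒜 𝒲 N, ∀ ζ ∈ Phase 𝒜 𝒲 N,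
        seqPair ((semidirectBracket ξ η).2.2 i) (ζ.2.1 i)
          - seqPair ((semidirectBracket ξ η).2.1 i) (ζ.2.2 i)
        = seqPair (ζ.2.1 i) (act (pos η.1) (ξ.2.2 i)) - seqPair (ζ.2.1 i) (act (pos ξ.1) (η.2.2 i))
          - (seqPair (η.2.1 i) (act (pos ξ.1) (ζ.2.2 i))
            - seqPair (ξ.2.1 i) (act (pos η.1) (ζ.2.2 i))) := by
      intro ξ hξ η hη ζ hζ
      simp only [semidirectBracket]
      rw [H.seqPair_sub_left (H.act_pos_mem hη.1 (hξ.2.2 i)) (H.act_pos_mem hξ.1 (hη.2.2 i))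
          (hζ.2.1 i),
        H.seqPair_sub_left (H.act_adj_pos_mem hξ.1 (hη.2.1 i)) (H.act_adj_pos_mem hη.1 (hξ.2.1 i))
          (hζ.2.2 i), H.seqPair_act_pos hξ.1 (hζ.2.2 i) (hη.2.1 i),
        H.seqPair_act_pos hη.1 (hζ.2.2 i) (hξ.2.1 i), seqPair_comm _ (ζ.2.1 i),
        seqPair_comm _ (ζ.2.1 i)]
    rw [key β hβ γ hγ α hα, key γ hγ α hα β hβ, key α hα β hβ γ hγ]
    ring

/-- In positive orders the dyads vanish and only `-[l, r_-]` is left. Its order is at most `m - 1`,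
and its coefficients lie in `𝒜` because those of `r_-` do. -/
theorem isTangent_theta {z ξ : Ext N} (hz : z ∈ Phase 𝒜 𝒲 N) (hξ : ξ ∈ Phase 𝒜 𝒲 N) {m : ℕ}
    (hm : 1 ≤ m) (hzm : IsMonic 𝒜 m z.1) : IsTangent 𝒜 m (theta z ξ).1 := by
  have hp : ∀ j : ℤ, 0 < j → (theta z ξ).1 j = -bracket z.1 (neg ξ.1) j := by
    intro j hj
    have hD : OrdLE 0 (∑ i, (dyad (z.2.1 i) (ξ.2.1 i) - dyad (ξ.2.2 i) (z.2.2 i))) :=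
      Finset.sum_induction _ (OrdLE 0) (fun _ _ h h' => h.add h') (fun _ _ _ => rfl)
        fun i _ => (dyad_ordLE _ _).sub (dyad_ordLE _ _)
    ext n
    change thetaOp z.1 ξ.1 j n + _ = _
    rw [hD j hj, add_zero, thetaOp_apply_of_pos hz.1.1 hξ.1.1 hj]
    rfl
  have hord : OrdLE (m + -1) (bracket z.1 (neg ξ.1)) := OrdLE.bracket hzm.2.1 (ordLE_neg ξ.1)
  refine ⟨fun j hj n => ?_, fun j => ?_⟩
  · rw [hp j (by omega), Pi.neg_apply, hord j (by omega), neg_zero]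
  · rcases le_or_gt j 0 with hj | hj
    · exact (H.theta_mem hz hξ).1.2.1 j hj
    · rw [hp j hj]
      have hn := H.coeff.alg_negPart hξ.1
      have hc := H.coeff.negPart_coeff_mem hξ.1
      exact H.coeff.neg (H.coeff.sub (H.coeff.mul_coeff_mem hz.1 hn hc j)
        (H.coeff.coeff_mul_mem hn hc hz.1 j))

/-! ### The Bäcklund transformation -/

theorem backlund_mem {z : Ext N} (hz : z ∈ Phase 𝒜 𝒲 N) : backlund z ∈ Phase 𝒜 𝒲 N :=
  ⟨H.coeff.alg_add hz.1 (H.alg_sum_dyad hz.2.1 hz.2.2), hz.2⟩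

theorem bijOn_backlund : Set.BijOn (backlund (N := N)) (Phase 𝒜 𝒲 N) (Phase 𝒜 𝒲 N) := by
  refine ⟨fun z hz => H.backlund_mem hz, ?_, ?_⟩
  · rintro ⟨l, f, g⟩ _ ⟨l', f', g'⟩ _ h
    simp only [backlund, Prod.mk.injEq] at h
    obtain ⟨h1, rfl, rfl⟩ := h
    rw [add_right_cancel h1]
  · intro z hz
    refine ⟨(z.1 - ∑ i, dyad (z.2.1 i) (z.2.2 i), z.2),
      ⟨H.coeff.alg_sub hz.1 (H.alg_sum_dyad hz.2.1 hz.2.2), hz.2⟩, ?_⟩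
    simp [backlund]

omit H in
theorem _root_.ShiftLax.sum_dyad_ordLE (f g : Fin N → ℤ → ℂ) :
    OrdLE 0 (∑ i, dyad (f i) (g i)) :=
  Finset.sum_induction _ (OrdLE 0) (fun _ _ h h' => h.add h') (fun _ _ _ => rfl)
    fun _ _ => dyad_ordLE _ _

theorem isMonic_add {A D : ShiftOp} (hD : D ∈ Alg 𝒜) (hD0 : OrdLE 0 D) {m : ℕ} (hm : 1 ≤ m)
    (hA : IsMonic 𝒜 m A) : IsMonic 𝒜 m (A + D) := by
  refine ⟨fun n => ?_, fun j hj n => ?_, fun j hj => H.coeff.add _ (hA.2.2 j hj) _ ?_⟩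
  · rw [ShiftOp.add_apply, hA.1, hD0 m (by omega), add_zero]
  · rw [ShiftOp.add_apply, hA.2.1 j hj, hD0 j (by omega), add_zero]
  · rcases le_or_gt j 0 with h | h
    · exact hD.2.1 j h
    · rw [show D j = 0 from funext (hD0 j h)]
      exact H.coeff.zero

theorem isMonic_backlund_iff {z : Ext N} (hz : z ∈ Phase 𝒜 𝒲 N) {m : ℕ} (hm : 1 ≤ m) :
    IsMonic 𝒜 m (backlund z).1 ↔ IsMonic 𝒜 m z.1 := by
  have hD := H.alg_sum_dyad hz.2.1 hz.2.2
  have hD0 := sum_dyad_ordLE z.2.1 z.2.2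
  refine ⟨fun h => ?_, H.isMonic_add hD hD0 hm⟩
  -- The inverse of `B` adds the negative of the same operator of order `≤ 0`, which does not reach
  -- the leading order `m ≥ 1`.
  have h' := H.isMonic_add (H.coeff.alg_neg hD) (fun j hj n => by simp [hD0 j hj]) hm h
  rwa [backlund, add_neg_cancel_right] at h'

theorem backlundDeriv_mem {z v : Ext N} (hz : z ∈ Phase 𝒜 𝒲 N) (hv : v ∈ Phase 𝒜 𝒲 N) :
    backlundDeriv z v ∈ Phase 𝒜 𝒲 N :=
  ⟨H.coeff.alg_add hv.1 (H.coeff.alg_sum _ fun i _ =>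
      H.coeff.alg_add (H.alg_dyad (hv.2.1 i) (hz.2.2 i)) (H.alg_dyad (hz.2.1 i) (hv.2.2 i))),
    hv.2⟩

-- Dyads are bilinear, so `B` is quadratic and the expansion stops, exactly, at `t ^ 2`.
omit H in
theorem _root_.ShiftLax.backlund_add_smul (z v : Ext N) (t : ℂ) :
    backlund (z + t • v) = backlund z + (t • backlundDeriv z v
      + t ^ 2 • ((∑ i, dyad (v.2.1 i) (v.2.2 i), 0, 0) : Ext N)) := by
  refine Prod.ext ?_ (Prod.ext ?_ ?_)
  · change z.1 + t • v.1 + ∑ i, dyad (z.2.1 i + t • v.2.1 i) (z.2.2 i + t • v.2.2 i)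
      = z.1 + ∑ i, dyad (z.2.1 i) (z.2.2 i)
        + (t • (v.1 + ∑ i, (dyad (v.2.1 i) (z.2.2 i) + dyad (z.2.1 i) (v.2.2 i)))
        + t ^ 2 • ∑ i, dyad (v.2.1 i) (v.2.2 i))
    have h : ∑ i, dyad (z.2.1 i + t • v.2.1 i) (z.2.2 i + t • v.2.2 i)
        = ∑ i, dyad (z.2.1 i) (z.2.2 i)
          + (t • ∑ i, (dyad (v.2.1 i) (z.2.2 i) + dyad (z.2.1 i) (v.2.2 i))
          + t ^ 2 • ∑ i, dyad (v.2.1 i) (v.2.2 i)) := by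
      rw [Finset.smul_sum, Finset.smul_sum, ← Finset.sum_add_distrib, ← Finset.sum_add_distrib]
      refine Finset.sum_congr rfl fun i _ => ?_
      simp only [dyad_add_left, dyad_add_right, dyad_smul_left, dyad_smul_right, smul_add,
        smul_smul, pow_two]
      abel
    rw [h, smul_add]
    abel
  · ext i n
    simp [backlund, backlundDeriv]
  · ext i n
    simp [backlund, backlundDeriv]

theorem hasDerivAt_backlund {z v ξ : Ext N} (hz : z ∈ Phase 𝒜 𝒲 N) (hv : v ∈ Phase 𝒜 𝒲 N)
    (hξ : ξ ∈ Phase 𝒜 𝒲 N) :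
    HasDerivAt (fun t : ℂ => pair ξ (backlund (z + t • v))) (pair ξ (backlundDeriv z v)) 0 := by
  set q : Ext N := (∑ i, dyad (v.2.1 i) (v.2.2 i), 0, 0) with hq
  have hqm : q ∈ Phase 𝒜 𝒲 N :=
    ⟨H.alg_sum_dyad hv.2.1 hv.2.2, fun _ => H.seq.zero, fun _ => H.seq.zero⟩
  have h : (fun t : ℂ => pair ξ (backlund (z + t • v)))
      = fun t : ℂ => pair ξ (backlund z) + (t * pair ξ (backlundDeriv z v) + t ^ 2 * pair ξ q) := by
    ext t
    have h1 := H.phase_smul t (H.backlundDeriv_mem hz hv)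
    have h2 := H.phase_smul (t ^ 2) hqm
    rw [backlund_add_smul, H.pair_add_right hξ (H.backlund_mem hz) (H.phase_add h1 h2),
      H.pair_add_right hξ h1 h2, pair_smul_right, pair_smul_right]
  rw [h]
  have hd := (((hasDerivAt_id (0 : ℂ)).mul_const (pair ξ (backlundDeriv z v))).add
    ((hasDerivAt_pow 2 (0 : ℂ)).mul_const (pair ξ q))).const_add (pair ξ (backlund z))
  simpa using! hd

theorem backlundAdj_mem {z ξ : Ext N} (hz : z ∈ Phase 𝒜 𝒲 N) (hξ : ξ ∈ Phase 𝒜 𝒲 N) :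
    backlundAdj z ξ ∈ Phase 𝒜 𝒲 N :=
  ⟨hξ.1, fun i => H.seq.add _ (hξ.2.1 i) _ (H.act_adj_pos_mem hξ.1 (hz.2.2 i)),
    fun i => H.seq.add _ (hξ.2.2 i) _ (H.act_pos_mem hξ.1 (hz.2.1 i))⟩

theorem pair_backlundAdj {z ξ v : Ext N} (hz : z ∈ Phase 𝒜 𝒲 N) (hξ : ξ ∈ Phase 𝒜 𝒲 N)
    (hv : v ∈ Phase 𝒜 𝒲 N) : pair (backlundAdj z ξ) v = pair ξ (backlundDeriv z v) := by
  have h1 := H.coeff.form_add_sum Finset.univ hξ.1 hv.1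
    (D := fun i => dyad (v.2.1 i) (z.2.2 i) + dyad (z.2.1 i) (v.2.2 i)) fun i =>
      H.coeff.alg_add (H.alg_dyad (hv.2.1 i) (hz.2.2 i)) (H.alg_dyad (hz.2.1 i) (hv.2.2 i))
  rw [pair, pair]
  simp only [backlundAdj, backlundDeriv]
  rw [h1, add_assoc, add_assoc, add_assoc]
  congr 1
  rw [← Finset.sum_add_distrib, ← Finset.sum_add_distrib, ← Finset.sum_add_distrib]
  refine Finset.sum_congr rfl fun i _ => ?_
  have hf := hz.2.1 i
  have hg := hz.2.2 i
  rw [H.coeff.form_add_right hξ.1 (H.alg_dyad (hv.2.1 i) hg) (H.alg_dyad hf (hv.2.2 i)),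
    H.form_dyad hξ.1 (hv.2.1 i) hg, H.form_dyad hξ.1 hf (hv.2.2 i),
    H.seqPair_add_left (hξ.2.1 i) (H.act_adj_pos_mem hξ.1 hg) (hv.2.1 i),
    H.seqPair_add_left (hξ.2.2 i) (H.act_pos_mem hξ.1 hf) (hv.2.2 i),
    H.seqPair_act_pos hξ.1 (hv.2.1 i) hg, seqPair_comm (act (pos ξ.1) (z.2.1 i))]
  ring

-- By additivity of `thetaOp` in `l`, the base point `B(z)` contributes one extra term per dyad, and
-- `thetaOp_dyad` identifies it with the terms that `B'^*` adds to `χ` and `ρ`.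
omit H in
theorem _root_.ShiftLax.theta_backlund {z ξ : Ext N} (hz : z ∈ Phase 𝒜 𝒲 N) (hξ : ξ ∈ Phase 𝒜 𝒲 N) :
    theta (backlund z) ξ = backlundDeriv z (thetaTilde z (backlundAdj z ξ)) := by
  refine Prod.ext ?_ (Prod.ext ?_ rfl)
  · change thetaOp (z.1 + ∑ i, dyad (z.2.1 i) (z.2.2 i)) ξ.1
        + ∑ i, (dyad (z.2.1 i) (ξ.2.1 i) - dyad (ξ.2.2 i) (z.2.2 i))
      = thetaOp z.1 ξ.1 + ∑ i, (dyad (-(ξ.2.2 i + act (pos ξ.1) (z.2.1 i))) (z.2.2 i)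
        + dyad (z.2.1 i) (ξ.2.1 i + act (adj (pos ξ.1)) (z.2.2 i)))
    rw [thetaOp_add_sum_left _ hz.1.1 hξ.1.1 fun i => dyad_ordLE _ _, add_assoc,
      ← Finset.sum_add_distrib]
    congr 1
    refine Finset.sum_congr rfl fun i _ => ?_
    rw [thetaOp_dyad _ _ hξ.1.1, dyad_neg_left, dyad_add_left, dyad_add_right]
    abel
  · ext i n
    simp only [theta, backlund, backlundDeriv, thetaTilde, backlundAdj, Pi.sub_apply,
      Pi.neg_apply, Pi.add_apply]
    ring

end IsExtSpace

/-! ### Powers and Casimir functionals -/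

theorem opPow_one (l : ShiftOp) : opPow l 1 = l := by
  ext j n
  exact (mulOp_mul_apply _ _ _ _).trans (one_mul _)

theorem opPow_add {l : ShiftOp} (hl : ∃ a, OrdLE a l) (p q : ℕ) :
    opPow l (p + q) = opPow l p * opPow l q := by
  obtain ⟨l, rfl⟩ := BddOp.exists_val_eq hl
  rw [← BddOp.val_pow, pow_add, BddOp.val_mul, BddOp.val_pow, BddOp.val_pow]

theorem exists_ordLE_opPow {l : ShiftOp} (hl : ∃ a, OrdLE a l) (p : ℕ) :
    ∃ a, OrdLE a (opPow l p) := by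
  obtain ⟨l, rfl⟩ := BddOp.exists_val_eq hl
  rw [← BddOp.val_pow]
  exact (l ^ p).exists_ordLE

theorem bracket_opPow {l : ShiftOp} (hl : ∃ a, OrdLE a l) (p : ℕ) : bracket l (opPow l p) = 0 := by
  have h1 := opPow_add hl p 1
  have h2 := opPow_add hl 1 p
  rw [opPow_one] at h1 h2
  rw [bracket, ← h1, ← h2, add_comm, sub_self]

theorem mul_assoc_of_exists {A B C : ShiftOp} (hA : ∃ a, OrdLE a A) (hB : ∃ a, OrdLE a B)
    (hC : ∃ a, OrdLE a C) : A * B * C = A * (B * C) := by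
  obtain ⟨a, ha⟩ := hA
  obtain ⟨b, hb⟩ := hB
  obtain ⟨c, hc⟩ := hC
  exact ha.mul_assoc hb hc

/-- Isolates the last factor `l`, in which the form is linear; this drives the inductions on the
exponent below. -/
theorem tr_mul_opPow_succ {a l : ShiftOp} (ha : ∃ m, OrdLE m a) (hl : ∃ m, OrdLE m l) (p : ℕ) :
    tr (a * opPow l (p + 1)) = form (a * opPow l p) l := by
  rw [form, mul_assoc_of_exists ha (exists_ordLE_opPow hl p) hl]
  rfl

theorem rMap_eq (A : ShiftOp) : rMap A = pos A + (-(1 / 2) : ℂ) • A := by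
  ext j n
  by_cases hj : 0 ≤ j
  · simp [rMap, pos_apply, neg_apply, hj, hj.not_gt]
    ring
  · simp [rMap, pos_apply, neg_apply, hj, not_le.mp hj]

theorem bracket_rMap {l g : ShiftOp} (hl : ∃ a, OrdLE a l) (hg : ∃ a, OrdLE a g)
    (h : bracket l g = 0) : bracket (rMap g) l = bracket (pos g) l := by
  have hs : ∃ a, OrdLE a ((-(1 / 2) : ℂ) • g) :=
    hg.imp fun a ha j hj n => by simp [ha j hj]
  rw [rMap_eq, bracket_add_left (exists_ordLE_pos hg) hs hl, bracket_neg_eq l (_ • g),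
    bracket_smul_right, h, smul_zero, neg_zero, add_zero]

/-- Commutation with `g` removes the truncated term, and zero sequence components of the covector
remove the dyads. -/
theorem coupledField_eq {N : ℕ} {g : ShiftOp} {z : Ext N} (h : bracket z.1 g = 0) :
    coupledField g z = -theta z (g, 0, 0) := by
  refine Prod.ext ?_ (Prod.ext ?_ ?_)
  · have hs : spos (0 : ShiftOp) = 0 := by
      ext j n
      simp [spos]
    simp only [coupledField, theta, Prod.fst_neg, Pi.zero_apply, dyad_zero_left, dyad_zero_right,
      h, hs, sub_zero, Finset.sum_const_zero, add_zero]
    exact bracket_neg_eq _ _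
  · ext i n
    simp [coupledField, theta]
  · ext i n
    simp [coupledField, theta]

/-! ### Uniqueness of gradients -/

/-- The operator with the single nonzero coefficient `1` at order `k` and position `m`. -/
def unitOp (k m : ℤ) : ShiftOp := fun j n => if j = k then (Pi.single m 1 : ℤ → ℂ) n else 0

/-- A unit operator reads off one coefficient, so the form is nondegenerate and gradients are
unique. -/
theorem form_unitOp (g : ShiftOp) (j m : ℤ) : form g (unitOp (-j) (m + j)) = g j m := by
  have h : ∀ n, (g * unitOp (-j) (m + j)) 0 n = if n = m then g j m else 0 := by
    intro n
    rw [ShiftOp.mul_apply, finsum_eq_single _ j fun i hi => by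
      rw [unitOp, if_neg (by omega), mul_zero]]
    rw [unitOp, if_pos (by omega)]
    by_cases hn : n = m
    · simp [hn]
    · rw [Pi.single_eq_of_ne (by omega), if_neg hn, mul_zero]
  rw [form, tr, tsum_congr h, tsum_ite_eq]

namespace IsExtSpace

variable {𝒜 𝒲 : Set (ℤ → ℂ)} (H : IsExtSpace 𝒜 𝒲) {N : ℕ}
include H

theorem alg_unitOp (k m : ℤ) : unitOp k m ∈ Alg 𝒜 := by
  have h : ∀ j, unitOp k m j ∈ 𝒜 := fun j => by
    by_cases hj : j = k
    · rw [show unitOp k m j = Pi.single m 1 from funext fun n => by rw [unitOp, if_pos hj]]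
      exact H.coeff.single m
    · rw [show unitOp k m j = 0 from funext fun n => by rw [unitOp, if_neg hj]; rfl]
      exact H.coeff.zero
  exact ⟨⟨k, fun j hj n => by simp [unitOp, hj.ne']⟩, fun j _ => h j,
    fun j _ => ⟨0, by simpa using h j⟩⟩

theorem isOpGradient_unique {γ : ShiftOp → ℂ} {l g g' : ShiftOp} (hg : IsOpGradient 𝒜 γ l g)
    (hg' : IsOpGradient 𝒜 γ l g') : g = g' := by
  ext j m
  have hu := H.alg_unitOp (-j) (m + j)
  rw [← form_unitOp g, ← form_unitOp g', (hg.2 _ hu).unique (hg'.2 _ hu)]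

theorem isGradient_comp_fst_iff {γ : ShiftOp → ℂ} {z ξ : Ext N} :
    IsGradient 𝒜 𝒲 (fun w => γ w.1) z ξ ↔
      IsOpGradient 𝒜 γ z.1 ξ.1 ∧ ξ.2 = 0 := by
  have h0 : ∀ f, seqPair f 0 = 0 := fun f => by simpa using seqPair_smul_right 0 f 0
  have h0' : ∀ f, seqPair 0 f = 0 := fun f => by simpa using seqPair_smul_left 0 0 f
  have hf0 : form ξ.1 0 = 0 := by simpa using form_smul_right 0 ξ.1 0
  constructor
  · rintro ⟨hξ, h⟩
    have hmem0 : ∀ (i k : Fin N) (m : ℤ), (Pi.single i (Pi.single m 1) : Fin N → ℤ → ℂ) k ∈ 𝒲 := by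
      intro i k m
      by_cases hk : k = i
      · subst hk
        simpa using H.seq.single m
      · rw [Pi.single_eq_of_ne hk]
        exact H.seq.zero
    -- The functional is constant in directions that do not move `l`; unit sequences placed in slot
    -- `i` then show that each sequence component of `ξ` is zero.
    have hconst : ∀ v : Ext N, v ∈ Phase 𝒜 𝒲 N → v.1 = 0 → pair ξ v = 0 := by
      intro v hv hv0
      have h1 := h v hv
      simp only [Prod.fst_add, Prod.smul_fst, hv0, smul_zero, add_zero] at h1
      exact h1.unique (hasDerivAt_const _ _)
    have hsum : ∀ (f : Fin N → ℤ → ℂ) (i : Fin N) (m : ℤ),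
        ∑ k, seqPair (f k) ((Pi.single i (Pi.single m 1) : Fin N → ℤ → ℂ) k) = f i m := by
      intro f i m
      rw [Finset.sum_eq_single i (fun k _ hk => by rw [Pi.single_eq_of_ne hk, h0])
        (fun hi => absurd (Finset.mem_univ i) hi), Pi.single_eq_same, seqPair_single_right]
    refine ⟨⟨hξ.1, fun h' hh' => ?_⟩, Prod.ext ?_ ?_⟩
    · have h1 := h (h', 0, 0) ⟨hh', fun _ => H.seq.zero, fun _ => H.seq.zero⟩
      simpa [pair, h0] using h1
    · ext i m
      have h1 := hconst (0, Pi.single i (Pi.single m 1), 0)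
        ⟨H.coeff.alg_zero, fun k => hmem0 i k m, fun _ => H.seq.zero⟩ rfl
      simpa [pair, h0, hf0, hsum] using h1
    · ext i m
      have h1 := hconst (0, 0, Pi.single i (Pi.single m 1))
        ⟨H.coeff.alg_zero, fun _ => H.seq.zero, fun k => hmem0 i k m⟩ rfl
      simpa [pair, h0, hf0, hsum] using h1
  · rintro ⟨h, h2⟩
    refine ⟨⟨h.1, fun i => by rw [h2]; exact H.seq.zero, fun i => by rw [h2]; exact H.seq.zero⟩,
      fun v hv => ?_⟩
    simpa [pair, h2, h0'] using h.2 v.1 hv.1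

theorem coupledField_eq_of_isCasimir {γ : ShiftOp → ℂ} (hγ : IsCasimir 𝒜 γ) {z ξ : Ext N}
    (hz : z ∈ Phase 𝒜 𝒲 N) (hξ : IsGradient 𝒜 𝒲 (fun w => γ w.1) z ξ) :
    coupledField ξ.1 z = -theta z ξ := by
  obtain ⟨h1, h2⟩ := H.isGradient_comp_fst_iff.mp hξ
  have hξ' : ξ = (ξ.1, 0, 0) := Prod.ext rfl h2
  rw [hξ']
  exact coupledField_eq ((hγ z.1 hz.1).2 ξ.1 h1)

end IsExtSpace

/-! ### Smoothness and gradients of the functionals `γ_n` -/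

namespace IsCoeffSpace

variable {𝒜 : Set (ℤ → ℂ)} (h𝒜 : IsCoeffSpace 𝒜)
include h𝒜

theorem alg_mul_opPow {a l : ShiftOp} (ha : a ∈ Alg 𝒜) (hl : l ∈ Alg 𝒜) (p : ℕ) :
    a * opPow l p ∈ Alg 𝒜 := by
  rcases Nat.eq_zero_or_pos p with rfl | hp
  · convert ha using 1
    ext j n
    exact (mul_mulOp_apply _ _ _ _).trans (mul_one _)
  · exact h𝒜.alg_mul ha (h𝒜.alg_opPow hl hp)

theorem form_mul_opPow {a l h : ShiftOp} (ha : a ∈ Alg 𝒜) (hl : l ∈ Alg 𝒜) (hh : h ∈ Alg 𝒜)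
    (p : ℕ) : form (a * opPow l p) h = tr (h * a * opPow l p) := by
  rw [h𝒜.form_comm (h𝒜.alg_mul_opPow ha hl p) hh, form,
    mul_assoc_of_exists hh.1 ha.1 (exists_ordLE_opPow hl.1 p)]

theorem form_add_sum_smul {ι : Type*} (s : Finset ι) {r l : ShiftOp} (hr : r ∈ Alg 𝒜)
    (hl : l ∈ Alg 𝒜) {h : ι → ShiftOp} (hh : ∀ i, h i ∈ Alg 𝒜) (t : ι → ℂ) :
    form r (l + ∑ i ∈ s, t i • h i) = form r l + ∑ i ∈ s, t i * form r (h i) := by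
  have := h𝒜.form_add_sum s hr hl fun i => h𝒜.alg_smul (t i) (hh i)
  simpa only [form_smul_right] using this

/-- Peeling off the last factor `L = l + ∑ t_i h_i` and moving it cyclically to the front gives `Tr
(a L^(p+1)) = Tr (l a L^p) + ∑ t_i Tr (h_i a L^p)`. The induction therefore runs over all `a`, and
the function is a polynomial in `t`. -/
theorem contDiff_tr_mul_opPow {k : ℕ} {l : ShiftOp} (hl : l ∈ Alg 𝒜) {h : Fin k → ShiftOp}
    (hh : ∀ i, h i ∈ Alg 𝒜) (p : ℕ) {a : ShiftOp} (ha : a ∈ Alg 𝒜) :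
    ContDiff ℂ (⊤ : ℕ∞) fun t : Fin k → ℂ => tr (a * opPow (l + ∑ i, t i • h i) p) := by
  induction p generalizing a with
  | zero => exact contDiff_const (c := tr (a * opPow l 0))
  | succ p ih =>
    have hL : ∀ t : Fin k → ℂ, l + ∑ i, t i • h i ∈ Alg 𝒜 := fun t =>
      h𝒜.alg_add hl (h𝒜.alg_sum _ fun i _ => h𝒜.alg_smul _ (hh i))
    have h1 : (fun t : Fin k → ℂ => tr (a * opPow (l + ∑ i, t i • h i) (p + 1)))
        = fun t => tr (l * a * opPow (l + ∑ i, t i • h i) p)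
          + ∑ i, t i * tr (h i * a * opPow (l + ∑ i, t i • h i) p) := by
      ext t
      rw [tr_mul_opPow_succ ha.1 (hL t).1,
        h𝒜.form_add_sum_smul _ (h𝒜.alg_mul_opPow ha (hL t) p) hl hh,
        h𝒜.form_mul_opPow ha (hL t) hl]
      simp only [h𝒜.form_mul_opPow ha (hL t) (hh _)]
    rw [h1]
    exact (ih (h𝒜.alg_mul hl ha)).add (ContDiff.sum fun i _ =>
      (contDiff_apply ℂ ℂ i).mul (ih (h𝒜.alg_mul (hh i) ha)))

theorem form_opPow_eq {l h : ShiftOp} (hl : l ∈ Alg 𝒜) (hh : h ∈ Alg 𝒜) {n : ℕ} (hn : 1 ≤ n) :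
    form (opPow l n) h = tr (h * opPow l n) :=
  h𝒜.form_comm (h𝒜.alg_opPow hl hn) hh

theorem contDiff_casimir {k : ℕ} {l : ShiftOp} (hl : l ∈ Alg 𝒜) {h : Fin k → ShiftOp}
    (hh : ∀ i, h i ∈ Alg 𝒜) {n : ℕ} (hn : 1 ≤ n) :
    ContDiff ℂ (⊤ : ℕ∞) fun t : Fin k → ℂ => casimir n (l + ∑ i, t i • h i) := by
  have hL : ∀ t : Fin k → ℂ, l + ∑ i, t i • h i ∈ Alg 𝒜 := fun t =>
    h𝒜.alg_add hl (h𝒜.alg_sum _ fun i _ => h𝒜.alg_smul _ (hh i))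
  have h1 : (fun t : Fin k → ℂ => casimir n (l + ∑ i, t i • h i))
      = fun t => (tr (l * opPow (l + ∑ i, t i • h i) n)
        + ∑ i, t i * tr (h i * opPow (l + ∑ i, t i • h i) n)) / ((n : ℂ) + 1) := by
    ext t
    rw [casimir, h𝒜.form_comm (hL t) (h𝒜.alg_opPow (hL t) hn),
      h𝒜.form_add_sum_smul _ (h𝒜.alg_opPow (hL t) hn) hl hh, h𝒜.form_opPow_eq (hL t) hl hn]
    simp only [h𝒜.form_opPow_eq (hL t) (hh _) hn]
  rw [h1]
  exact ((h𝒜.contDiff_tr_mul_opPow hl hh n hl).add (ContDiff.sum fun i _ =>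
    (contDiff_apply ℂ ℂ i).mul (h𝒜.contDiff_tr_mul_opPow hl hh n (hh i)))).div_const _

theorem continuous_tr_mul_opPow {l h a : ShiftOp} (hl : l ∈ Alg 𝒜) (hh : h ∈ Alg 𝒜)
    (ha : a ∈ Alg 𝒜) (p : ℕ) : Continuous fun t : ℂ => tr (a * opPow (l + t • h) p) := by
  have h1 := (h𝒜.contDiff_tr_mul_opPow (k := 1) hl (h := fun _ => h) (fun _ => hh) p ha).continuous
  simpa [Function.comp_def] using h1.comp (continuous_pi fun _ => continuous_id)

-- At `t = 0` the product rule needs only continuity of the second factor.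
omit h𝒜 in
theorem _root_.ShiftLax.hasDerivAt_mul_of_continuous {g : ℂ → ℂ} (hg : Continuous g) :
    HasDerivAt (fun t => t * g t) (g 0) 0 := by
  rw [hasDerivAt_iff_tendsto_slope_zero]
  refine (hg.tendsto 0).mono_left nhdsWithin_le_nhds |>.congr' ?_
  filter_upwards [self_mem_nhdsWithin] with t ht
  have : t ≠ 0 := ht
  simp [this]

/-- Each peeled factor raises the fixed power of `l` by one and contributes one term `t * Tr (h
...)`, whose derivative at `0` is always `Tr (h l^(p+q))`. The exponent `q + 1` keeps the fixed
power in `Alg 𝒜`. -/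
theorem hasDerivAt_tr_opPow_mul_opPow {l h : ShiftOp} (hl : l ∈ Alg 𝒜) (hh : h ∈ Alg 𝒜)
    (p q : ℕ) : HasDerivAt (fun t : ℂ => tr (opPow l (q + 1) * opPow (l + t • h) p))
      (p * tr (h * opPow l (p + q))) 0 := by
  induction p generalizing q with
  | zero => simpa [opPow] using hasDerivAt_const (0 : ℂ) (tr (opPow l (q + 1) * opPow l 0))
  | succ p ih =>
    have hL : ∀ t : ℂ, l + t • h ∈ Alg 𝒜 := fun t => h𝒜.alg_add hl (h𝒜.alg_smul t hh)
    have hq := h𝒜.alg_opPow hl (Nat.succ_pos q)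
    have hlq : l * opPow l (q + 1) = opPow l (q + 1 + 1) := by
      rw [add_comm (q + 1), opPow_add hl.1 1, opPow_one]
    have h1 : (fun t : ℂ => tr (opPow l (q + 1) * opPow (l + t • h) (p + 1)))
        = fun t => tr (opPow l (q + 1 + 1) * opPow (l + t • h) p)
          + t * tr (h * opPow l (q + 1) * opPow (l + t • h) p) := by
      ext t
      have hm := h𝒜.alg_mul_opPow hq (hL t) p
      rw [tr_mul_opPow_succ hq.1 (hL t).1, h𝒜.form_add_right hm hl (h𝒜.alg_smul t hh),
        form_smul_right, h𝒜.form_mul_opPow hq (hL t) hl, h𝒜.form_mul_opPow hq (hL t) hh, hlq]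
    rw [h1]
    have h2 := (ih (q + 1)).add (hasDerivAt_mul_of_continuous
      (h𝒜.continuous_tr_mul_opPow hl hh (h𝒜.alg_mul hh hq) p))
    refine h2.congr_deriv ?_
    rw [zero_smul, add_zero, mul_assoc_of_exists hh.1 hq.1 (exists_ordLE_opPow hl.1 p),
      ← opPow_add hl.1]
    have e1 : p + 1 + q = p + (q + 1) := by ring
    have e2 : q + 1 + p = p + (q + 1) := by ring
    rw [e1, e2]
    push_cast
    ring

/-- The power `(l + t h)^n` contributes `n` copies of `Tr (h l^n)` and the remaining factor one
more, which cancels the denominator `n + 1`. -/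
theorem isOpGradient_casimir {l : ShiftOp} (hl : l ∈ Alg 𝒜) {n : ℕ} (hn : 1 ≤ n) :
    IsOpGradient 𝒜 (casimir n) l (opPow l n) := by
  refine ⟨h𝒜.alg_opPow hl hn, fun h hh => ?_⟩
  have hL : ∀ t : ℂ, l + t • h ∈ Alg 𝒜 := fun t => h𝒜.alg_add hl (h𝒜.alg_smul t hh)
  have h1 : (fun t : ℂ => casimir n (l + t • h))
      = fun t => (tr (opPow l (0 + 1) * opPow (l + t • h) n)
        + t * tr (h * opPow (l + t • h) n)) / ((n : ℂ) + 1) := by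
    ext t
    have hp := h𝒜.alg_opPow (hL t) hn
    rw [casimir, h𝒜.form_comm (hL t) hp, h𝒜.form_add_right hp hl (h𝒜.alg_smul t hh),
      form_smul_right, h𝒜.form_opPow_eq (hL t) hl hn, h𝒜.form_opPow_eq (hL t) hh hn, zero_add,
      opPow_one]
  rw [h1, h𝒜.form_opPow_eq hl hh hn]
  have h2 := ((h𝒜.hasDerivAt_tr_opPow_mul_opPow hl hh n 0).add (hasDerivAt_mul_of_continuous
    (h𝒜.continuous_tr_mul_opPow hl hh hh n))).div_const ((n : ℂ) + 1)
  refine h2.congr_deriv ?_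
  have hn0 : (n : ℂ) + 1 ≠ 0 := by exact_mod_cast Nat.succ_ne_zero n
  rw [zero_smul, add_zero, add_zero]
  field_simp

end IsCoeffSpace

namespace IsExtSpace

variable {𝒜 𝒲 : Set (ℤ → ℂ)} (H : IsExtSpace 𝒜 𝒲) {N : ℕ}
include H

theorem isCasimir_casimir {n : ℕ} (hn : 1 ≤ n) : IsCasimir 𝒜 (casimir n) := fun l hl =>
  ⟨⟨_, H.coeff.isOpGradient_casimir hl hn⟩, fun g hg => by
    rw [H.isOpGradient_unique hg (H.coeff.isOpGradient_casimir hl hn), bracket_opPow hl.1]⟩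

theorem isGradient_casimir_iff {n : ℕ} (hn : 1 ≤ n) {z : Ext N} (hz : z ∈ Phase 𝒜 𝒲 N)
    (η : Ext N) :
    IsGradient 𝒜 𝒲 (fun w : Ext N => casimir n w.1) z η ↔ η = (opPow z.1 n, 0, 0) := by
  rw [H.isGradient_comp_fst_iff]
  constructor
  · rintro ⟨h1, h2⟩
    exact Prod.ext (H.isOpGradient_unique h1 (H.coeff.isOpGradient_casimir hz.1 hn)) h2
  · rintro rfl
    exact ⟨H.coeff.isOpGradient_casimir hz.1 hn, rfl⟩

theorem isSmoothFunctional_casimir {n : ℕ} (hn : 1 ≤ n) :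
    IsSmoothFunctional 𝒜 𝒲 (fun w : Ext N => casimir n w.1) := by
  refine ⟨fun z hz k v hv => ?_, fun z hz => ⟨_, (H.isGradient_casimir_iff hn hz _).mpr rfl⟩⟩
  have h := H.coeff.contDiff_casimir hz.1 (fun i => (hv i).1) hn
  simpa [Prod.fst_sum] using h

end IsExtSpace

end ShiftLax

end

/-! ### The main theorem -/

open ShiftLax

theorem theorem2 (N : ℕ) (𝒜 𝒲 : Set (ℤ → ℂ))
    (h𝒜𝒲 : (𝒜 = Schwartz ∧ 𝒲 = Schwartz) ∨ (𝒜 = L1 ∧ 𝒲 = L2)) :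
    -- `B` is a bijection of the phase space with derivative `B'` and conjugate `B'^*`
    (Set.BijOn (backlund (N := N)) (Phase 𝒜 𝒲 N) (Phase 𝒜 𝒲 N) ∧
      (∀ z ∈ Phase 𝒜 𝒲 N, ∀ m : ℕ, 1 ≤ m → (IsMonic 𝒜 m (backlund z).1 ↔ IsMonic 𝒜 m z.1)) ∧
      (∀ z ∈ Phase 𝒜 𝒲 N, ∀ v ∈ Phase 𝒜 𝒲 N, backlundDeriv z v ∈ Phase 𝒜 𝒲 N ∧
        ∀ ξ ∈ Phase 𝒜 𝒲 N,
          HasDerivAt (fun t : ℂ => pair ξ (backlund (z + t • v))) (pair ξ (backlundDeriv z v)) 0) ∧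
      (∀ z ∈ Phase 𝒜 𝒲 N, ∀ ξ ∈ Phase 𝒜 𝒲 N, backlundAdj z ξ ∈ Phase 𝒜 𝒲 N ∧
        ∀ v ∈ Phase 𝒜 𝒲 N, pair (backlundAdj z ξ) v = pair ξ (backlundDeriv z v))) ∧
    -- `Θ` is the transform `B' Θ̃ B'^*` of the Poisson structure `Θ̃`
    (∀ z ∈ Phase 𝒜 𝒲 N, ∀ ξ ∈ Phase 𝒜 𝒲 N,
      theta (backlund z) ξ = backlundDeriv z (thetaTilde z (backlundAdj z ξ))) ∧
    -- `Θ̃` and `Θ` are Poisson structures; `Θ` is tangent to each set of monic operators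
    IsImplectic 𝒜 𝒲 (thetaTilde (N := N)) ∧
    IsImplectic 𝒜 𝒲 (theta (N := N)) ∧
    (∀ z ∈ Phase 𝒜 𝒲 N, ∀ m : ℕ, 1 ≤ m → IsMonic 𝒜 m z.1 →
      ∀ ξ ∈ Phase 𝒜 𝒲 N, IsTangent 𝒜 m (theta z ξ).1) ∧
    -- the flow of every Casimir functional of `l` is Hamiltonian with respect to `Θ`
    (∀ γ : ShiftOp → ℂ, IsCasimir 𝒜 γ → ∀ z ∈ Phase 𝒜 𝒲 N, ∀ ξ : Ext N,
      IsGradient 𝒜 𝒲 (fun w => γ w.1) z ξ → coupledField ξ.1 z = -theta z ξ) ∧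
    -- in particular the hierarchy, with the Hamiltonians `γ_n`
    (∀ n : ℕ, 1 ≤ n →
      (∀ l ∈ Alg 𝒜, Summable fun k => ‖(l * opPow l n) 0 k‖) ∧
      IsCasimir 𝒜 (casimir n) ∧
      IsSmoothFunctional 𝒜 𝒲 (fun w : Ext N => casimir n w.1) ∧
      ∀ z ∈ Phase 𝒜 𝒲 N,
        bracket (rMap (opPow z.1 n)) z.1 = bracket (pos (opPow z.1 n)) z.1 ∧
        coupledField (opPow z.1 n) z ∈ Phase 𝒜 𝒲 N ∧
        ∃ ξ : Ext N, ξ = (opPow z.1 n, 0, 0) ∧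
          (∀ η : Ext N, IsGradient 𝒜 𝒲 (fun w : Ext N => casimir n w.1) z η ↔ η = ξ) ∧
          coupledField (opPow z.1 n) z = -theta z ξ) ∧
    -- rapidly decreasing coefficients of `l` are kept by the hierarchy also for `𝐟, 𝐟^*` in `ℓ²`
    (∀ n : ℕ, 1 ≤ n → ∀ z ∈ Phase Schwartz L2 N,
      z ∈ Phase L1 L2 N ∧ coupledField (opPow z.1 n) z ∈ Phase Schwartz L2 N) := by
  have H : IsExtSpace 𝒜 𝒲 := by
    rcases h𝒜𝒲 with ⟨rfl, rfl⟩ | ⟨rfl, rfl⟩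
    · exact isExtSpace_Schwartz
    · exact isExtSpace_L1_L2
  refine ⟨⟨H.bijOn_backlund, fun z hz m hm => H.isMonic_backlund_iff hz hm,
    fun z hz v hv => ⟨H.backlundDeriv_mem hz hv, fun ξ hξ => H.hasDerivAt_backlund hz hv hξ⟩,
    fun z hz ξ hξ => ⟨H.backlundAdj_mem hz hξ, fun v hv => H.pair_backlundAdj hz hξ hv⟩⟩,
    fun z hz ξ hξ => theta_backlund hz hξ, H.isImplectic_thetaTilde, H.isImplectic_theta,
    fun z hz m hm hzm ξ hξ => H.isTangent_theta hz hξ hm hzm,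
    fun γ hγ z hz ξ hξ => H.coupledField_eq_of_isCasimir hγ hz hξ, fun n hn => ?_, ?_⟩
  · refine ⟨fun l hl => H.coeff.summable_coeff_zero (H.coeff.alg_mul_opPow hl hl n),
      H.isCasimir_casimir hn, H.isSmoothFunctional_casimir hn, fun z hz => ?_⟩
    have hp := H.coeff.alg_opPow hz.1 hn
    have hc := bracket_opPow hz.1.1 n
    exact ⟨bracket_rMap hz.1.1 hp.1 hc, coupledField_mem H.coeff H.seq hz hp, _, rfl,
      H.isGradient_casimir_iff hn hz, coupledField_eq hc⟩
  · intro n hn z hz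
    -- The pair `𝒮(ℤ)`, `ℓ²` does not satisfy `IsExtSpace`, since products of `ℓ²` sequences need
    -- not decrease rapidly; only the membership of the coupled field, free of such products, is
    -- used here.
    refine ⟨⟨⟨hz.1.1, fun j hj => Schwartz_subset_L1 (hz.1.2.1 j hj), fun j hj => ?_⟩, hz.2⟩,
      coupledField_mem isCoeffSpace_Schwartz isSeqSpace_L2 hz
        (isCoeffSpace_Schwartz.alg_opPow hz.1 hn)⟩
    obtain ⟨c, hc⟩ := hz.1.2.2 j hj
    exact ⟨c, Schwartz_subset_L1 hc⟩
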